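/- **Monoids of cups and caps.** $\mathcal L_\omega$ is the monoid presented by generators $\lfloor k\rfloor$ (cups) and $\lceil k\rceil$ (caps), $k\ge 1$, and the relations, for all $1\le l\le k$: $\lfloor k\rfloor\lfloor l\rfloor=\lfloor l\rfloor\lfloor k+2\rfloor$; $\lceil l\rceil\lceil k\rceil=\lceil k+2\rceil\lceil l\rceil$; $\lfloor l\rfloor\lceil k+2\rceil=\lceil k\rceil\lfloor l\rfloor$; $\lfloor k+2\rfloor\lceil l\rceil=\lceil l\rceil\lfloor k\rfloor$; $\lfloor k\rfloor\lceil k\pm1\rceil=\mathbf 1$ (whenever $k\pm 1\ge 1$). $\mathcal K_\omega$ has in addition $\lfloor k\rfloor\lceil k\rceil=\lfloor k+1\rfloor\lceil k+1\rceil$, and $\mathcal J_\omega$ has instead in addition $\lfloor k\rfloor\lceil k\rceil=\mathbf 1$, for all $k\geq 1$. *Terms* are formal expressions built from $\mathbf 1$, cups and caps by a binary product. **Self-adjunctions.** An $\mathcal L$-adjunction is a category with an endofunctor $F$ that is adjoint to itself, with counit $\varphi_a:FFa\to a$ and unit $\gamma_a:a\to FFa$ (natural, with $F\varphi_a\circ\gamma_{Fa}=\varphi_{Fa}\circ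 F\gamma_a=\mathbf 1_{Fa}$). It is a $\mathcal K$-adjunction if also $F(\varphi_a\circ\gamma_a)=\varphi_{Fa}\circ\gamma_{Fa}$ for all $a$, and a $\mathcal J$-adjunction if also $\varphi_a\circ\gamma_a=\mathbf 1_a$ for all $a$. Let $\mathcal X\in\{\mathcal L,\mathcal K,\mathcal J\}$. The category $\mathcal X_c$ of the free $\mathcal X$-adjunction generated by one object $0$ has as objects the numbers $n\in\mathbf N$ ($n$ stands for $F^n0$). *Arrow-terms* are generated from $\mathbf 1_n:n\to n$, $\varphi_n:n+2\to n$, $\gamma_n:n\to n+2$ by $f\mapsto Ff$ (from $m\to n$ to $m+1\to n+1$) and typed composition $g\circ f$; the arrows of $\mathcal X_c$ are the arrow-terms modulo the smallest equivalence relation, congruent for $F$ and $\circ$, that satisfies the equations of $\mathcal X$-adjunctions. For $f:m\to n$ and $g:k\to l$ let $g\ast f$ be $g\circ F^{k-n}f$ if $n\le k$ and $F^{n-k}g\circ f$ if $k\le n$ (both for arrow-terms and for arrows). For arrows $f,g$ of $\mathcal X_c$ let $f\equiv_{\mathcal X}g$ iff $F^kf=F^lg$ in $\mathcal X_c$ for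 some $k,l\in\mathbf N$. The classes $[f]$ form a monoid $\mathcal X_c^\ast$ with $[g][f]=[g\ast f]$ and unit $[\mathbf 1_0]$. Define $\psi$ from arrow-terms to terms by $\psi(\mathbf 1_n)=\mathbf 1$, $\psi(\varphi_n)=\lfloor n+1\rfloor$, $\psi(\gamma_n)=\lceil n+1\rceil$, $\psi(Ff)=\psi(f)$, $\psi(g\circ f)=\psi(g)\psi(f)$, and $\chi$ from terms to arrow-terms by $\chi(\mathbf 1)=\mathbf 1_0$, $\chi(\lfloor k\rfloor)=\varphi_{k-1}$, $\chi(\lceil k\rceil)=\gamma_{k-1}$, $\chi(tu)=\chi(t)\ast\chi(u)$. **Theorem.** For each $\mathcal X\in\{\mathcal L,\mathcal K,\mathcal J\}$: 1. ($\psi$ Lemma) if $f=g$ in $\mathcal X_c$, then $\psi(f)=\psi(g)$ in $\mathcal X_\omega$; 2. ($\chi$ Lemma) if $t=u$ in $\mathcal X_\omega$, then $\chi(t)\equiv_{\mathcal X}\chi(u)$; 3. ($\chi\psi$ Lemma) $\chi(\psi(f))\equiv_{\mathcal X}f$ for every arrow-term $f$; 4. ($\psi\chi$ Lemma) for every term $t$,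 $\psi(\chi(t))$ is the term $t$ itself; 5. $[f]\mapsto\psi(f)$ is an isomorphism of monoids $\mathcal X_c^\ast\cong\mathcal X_\omega$ with inverse $t\mapsto[\chi(t)]$. Moreover: 6. (Cancellation) In every $\mathcal L$-adjunction, for $f,g:a\to Fb$ or $f,g:Fa\to b$, $Ff=Fg$ implies $f=g$. In every $\mathcal J$-adjunction, and in $\mathcal K_c$, $Ff=Fg$ implies $f=g$ for all $f,g$ of the same type. 7. For arrow-terms $f,g:m\to n$, where $m+n>0$ if $\mathcal X=\mathcal L$: $f=g$ in $\mathcal X_c$ iff $f\equiv_{\mathcal X}g$ iff $\psi(f)=\psi(g)$ in $\mathcal X_\omega$. 8. For $n\in\mathbf N$ let $\mathcal K_n$ be the monoid presented by generators $c$ and $h_i$ ($1\le i\le n-1$) and the relations $h_ih_{j+2}=h_{j+2}h_i$ for $i\le j$, $h_ih_{i\pm1}h_i=h_i$, $h_ic=ch_i$, $h_ih_i=ch_i$, and let $\mathcal J_n$ be $\mathcal K_n$ with the additional relation $c=\mathbf 1$. Then for every $n\in\mathbf N$, $\mathcal K_n$ is isomorphic to the monoid of endomorphisms $n\to n$ of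 $\mathcal K_c$, and $\mathcal J_n$ to the monoid of endomorphisms $n\to n$ of $\mathcal J_c$ (with product $g\circ f$), by isomorphisms that send $h_i$ to $F^{n-i-1}(\gamma_{i-1}\circ\varphi_{i-1})$ and $c$ to $\varphi_n\circ\gamma_n$. -/

import Mathlib

open CategoryTheory

universe v u

namespace SelfAdj

/-- The three notions of self-adjunction. -/
inductive Kind
  | L
  | K
  | J

/-- Terms over cups and caps, built from the generators and the unit by a binary product
(no associativity or unit law is imposed). -/
inductive Term
  | one : Term
  | cup (k : ℕ+) : Term
  | cap (k : ℕ+) : Term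
  | mul (t u : Term) : Term

/-- The generators of `𝓛_ω`, `𝓚_ω` and `𝓙_ω`. -/
inductive Gen
  | cup (k : ℕ+)
  | cap (k : ℕ+)

/-- The cup `⌊k⌋` as a word. -/
def wcup (k : ℕ+) : FreeMonoid Gen := FreeMonoid.of (Gen.cup k)

/-- The cap `⌈k⌉` as a word. -/
def wcap (k : ℕ+) : FreeMonoid Gen := FreeMonoid.of (Gen.cap k)

/-- The defining equations of `𝓛_ω`, together with the additional equation of `𝓚_ω` or
of `𝓙_ω`, according to the kind. -/
inductive OmegaRel (κ : Kind) : FreeMonoid Gen → FreeMonoid Gen → Prop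
  | cup_cup (k l : ℕ+) (h : l ≤ k) :
      OmegaRel κ (wcup k * wcup l) (wcup l * wcup (k + 2))
  | cap_cap (k l : ℕ+) (h : l ≤ k) :
      OmegaRel κ (wcap l * wcap k) (wcap (k + 2) * wcap l)
  | cup_cap_one (k l : ℕ+) (h : l ≤ k) :
      OmegaRel κ (wcup l * wcap (k + 2)) (wcap k * wcup l)
  | cup_cap_two (k l : ℕ+) (h : l ≤ k) :
      OmegaRel κ (wcup (k + 2) * wcap l) (wcap l * wcup k)
  | cup_cap_three_add (k : ℕ+) :
      OmegaRel κ (wcup k * wcap (k + 1)) 1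
  | cup_cap_three_sub (k : ℕ+) :
      OmegaRel κ (wcup (k + 1) * wcap k) 1
  | cup_cap_four (hκ : κ = Kind.K) (k : ℕ+) :
      OmegaRel κ (wcup k * wcap k) (wcup (k + 1) * wcap (k + 1))
  | circle (hκ : κ = Kind.J) (k : ℕ+) :
      OmegaRel κ (wcup k * wcap k) 1

/-- The monoid `𝓛_ω`, `𝓚_ω` or `𝓙_ω`. -/
abbrev Omega (κ : Kind) : Type := PresentedMonoid (OmegaRel κ)

/-- The element of `𝓛_ω`, `𝓚_ω` or `𝓙_ω` denoted by a term. -/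
def Term.eval (κ : Kind) : Term → Omega κ
  | .one => 1
  | .cup k => PresentedMonoid.of (OmegaRel κ) (Gen.cup k)
  | .cap k => PresentedMonoid.of (OmegaRel κ) (Gen.cap k)
  | .mul t u => t.eval κ * u.eval κ

/-- Arrow-terms, indexed by their source and target. -/
inductive ArrowTerm : ℕ → ℕ → Type
  | one (n : ℕ) : ArrowTerm n n
  | phi (n : ℕ) : ArrowTerm (n + 2) n
  | gam (n : ℕ) : ArrowTerm n (n + 2)
  | F {m n : ℕ} (f : ArrowTerm m n) : ArrowTerm (m + 1) (n + 1)
  | comp {m n k : ℕ} (g : ArrowTerm n k) (f : ArrowTerm m n) : ArrowTerm m k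

open ArrowTerm in
/-- The smallest equivalence relation on arrow-terms that is a congruence for `F` and
composition and satisfies the `𝓛`-, `𝓚`- or `𝓙`-equations. -/
inductive TermEq (κ : Kind) : {m n : ℕ} → ArrowTerm m n → ArrowTerm m n → Prop
  | refl {m n : ℕ} (f : ArrowTerm m n) : TermEq κ f f
  | symm {m n : ℕ} {f g : ArrowTerm m n} : TermEq κ f g → TermEq κ g f
  | trans {m n : ℕ} {f g h : ArrowTerm m n} : TermEq κ f g → TermEq κ g h → TermEq κ f h
  | congr_F {m n : ℕ} {f g : ArrowTerm m n} : TermEq κ f g → TermEq κ (F f) (F g)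
  | congr_comp {m n k : ℕ} {g₁ g₂ : ArrowTerm n k} {f₁ f₂ : ArrowTerm m n} :
      TermEq κ f₁ f₂ → TermEq κ g₁ g₂ → TermEq κ (comp g₁ f₁) (comp g₂ f₂)
  | comp_one {m n : ℕ} (f : ArrowTerm m n) : TermEq κ (comp f (one m)) f
  | one_comp {m n : ℕ} (f : ArrowTerm m n) : TermEq κ (comp (one n) f) f
  | assoc {m n k l : ℕ} (h : ArrowTerm k l) (g : ArrowTerm n k) (f : ArrowTerm m n) :
      TermEq κ (comp h (comp g f)) (comp (comp h g) f)
  | F_one (n : ℕ) : TermEq κ (F (one n)) (one (n + 1))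
  | F_comp {m n k : ℕ} (g : ArrowTerm n k) (f : ArrowTerm m n) :
      TermEq κ (F (comp g f)) (comp (F g) (F f))
  | nat_phi {m n : ℕ} (f : ArrowTerm m n) :
      TermEq κ (comp f (phi m)) (comp (phi n) (F (F f)))
  | nat_gam {m n : ℕ} (f : ArrowTerm m n) :
      TermEq κ (comp (F (F f)) (gam m)) (comp (gam n) f)
  | triangle_left (n : ℕ) : TermEq κ (comp (F (phi n)) (gam (n + 1))) (one (n + 1))
  | triangle_right (n : ℕ) : TermEq κ (comp (phi (n + 1)) (F (gam n))) (one (n + 1))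
  | phi_gam_K (hκ : κ = Kind.K) (n : ℕ) :
      TermEq κ (F (comp (phi n) (gam n))) (comp (phi (n + 1)) (gam (n + 1)))
  | phi_gam_J (hκ : κ = Kind.J) (n : ℕ) : TermEq κ (comp (phi n) (gam n)) (one n)

/-- Equality of arrow-terms of the same type, as a setoid. -/
def termSetoid (κ : Kind) (m n : ℕ) : Setoid (ArrowTerm m n) where
  r := TermEq κ
  iseqv := ⟨TermEq.refl, TermEq.symm, TermEq.trans⟩

/-- The arrows `m → n` of `𝓛_c`, `𝓚_c` or `𝓙_c`. -/
def Arr (κ : Kind) (m n : ℕ) : Type := Quotient (termSetoid κ m n)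

/-- The arrow denoted by an arrow-term. -/
def ArrowTerm.toArr (κ : Kind) {m n : ℕ} (f : ArrowTerm m n) : Arr κ m n :=
  Quotient.mk (termSetoid κ m n) f

namespace Arr

variable {κ : Kind}

/-- The identity arrow. -/
def one (n : ℕ) : Arr κ n n := (ArrowTerm.one n).toArr κ

/-- The counit `φ`. -/
def phi (n : ℕ) : Arr κ (n + 2) n := (ArrowTerm.phi n).toArr κ

/-- The unit `γ`. -/
def gam (n : ℕ) : Arr κ n (n + 2) := (ArrowTerm.gam n).toArr κ

/-- The functor `F` on arrows. -/
def F {m n : ℕ} : Arr κ m n → Arr κ (m + 1) (n + 1) :=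
  Quotient.lift (fun f => (ArrowTerm.F f).toArr κ)
    (fun _ _ h => Quotient.sound (TermEq.congr_F h))

/-- Composition, written in the order of `g ∘ f`. -/
def comp {m n k : ℕ} : Arr κ n k → Arr κ m n → Arr κ m k :=
  Quotient.lift₂ (fun g f => (ArrowTerm.comp g f).toArr κ)
    (fun _ _ _ _ hg hf => Quotient.sound (TermEq.congr_comp hf hg))

theorem comp_one {m n : ℕ} (f : Arr κ m n) : comp f (one m) = f := by
  induction f using Quotient.inductionOn with
  | _ f => exact Quotient.sound (TermEq.comp_one f)

theorem one_comp {m n : ℕ} (f : Arr κ m n) : comp (one n) f = f := by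
  induction f using Quotient.inductionOn with
  | _ f => exact Quotient.sound (TermEq.one_comp f)

theorem assoc {m n k l : ℕ} (h : Arr κ k l) (g : Arr κ n k) (f : Arr κ m n) :
    comp h (comp g f) = comp (comp h g) f := by
  induction f using Quotient.inductionOn with
  | _ f =>
    induction g using Quotient.inductionOn with
    | _ g =>
      induction h using Quotient.inductionOn with
      | _ h => exact Quotient.sound (TermEq.assoc h g f)

theorem F_comp {m n k : ℕ} (g : Arr κ n k) (f : Arr κ m n) :
    F (comp g f) = comp (F g) (F f) := by
  induction f using Quotient.inductionOn with
  | _ f =>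
    induction g using Quotient.inductionOn with
    | _ g => exact Quotient.sound (TermEq.F_comp g f)

end Arr

/-- The objects of `𝓛_c`, `𝓚_c` or `𝓙_c`; `⟨n⟩` is the object `F^n 0`. -/
structure FreeCat (κ : Kind) where
  idx : ℕ

/-- The categories `𝓛_c`, `𝓚_c` and `𝓙_c` of the free self-adjunctions generated by one object. -/
instance (κ : Kind) : Category (FreeCat κ) where
  Hom a b := Arr κ a.idx b.idx
  id a := Arr.one a.idx
  comp f g := Arr.comp g f
  id_comp f := Arr.comp_one f
  comp_id f := Arr.one_comp f
  assoc f g h := Arr.assoc h g f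

/-- An element of a family `H m n` of "arrows `m → n`", with its source and target. -/
structure Any (H : ℕ → ℕ → Type) where
  {dom : ℕ}
  {cod : ℕ}
  arr : H dom cod

/-- `F^j f`. -/
def shift (H : ℕ → ℕ → Type) (F : {m n : ℕ} → H m n → H (m + 1) (n + 1)) {m n : ℕ}
    (f : H m n) : (j : ℕ) → H (m + j) (n + j)
  | 0 => f
  | j + 1 => F (shift H F f j)

/-- The total operation `g ∗ f` determined by `F` and composition: for `f : m → n` and
`g : k → l` it is `g ∘ F^(k-n) f` if `n ≤ k`, and `F^(n-k) g ∘ f` if `k ≤ n`. -/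
def starOf (H : ℕ → ℕ → Type) (F : {m n : ℕ} → H m n → H (m + 1) (n + 1))
    (comp : {m n k : ℕ} → H n k → H m n → H m k) (g f : Any H) : Any H :=
  if h : f.cod ≤ g.dom then
    ⟨comp g.arr ((Nat.add_sub_of_le h) ▸ shift H F f.arr (g.dom - f.cod))⟩
  else
    ⟨comp ((Nat.add_sub_of_le (Nat.le_of_not_le h)) ▸ shift H F g.arr (f.cod - g.dom)) f.arr⟩

/-- The operation `∗` on arrow-terms. -/
def termStar (g f : Any ArrowTerm) : Any ArrowTerm :=
  starOf ArrowTerm ArrowTerm.F ArrowTerm.comp g f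

/-- The operation `∗` on the arrows of `𝓛_c`, `𝓚_c` or `𝓙_c`. -/
def arrStar {κ : Kind} (g f : Any (Arr κ)) : Any (Arr κ) :=
  starOf (Arr κ) Arr.F Arr.comp g f

/-- `F` on arrows whose type is not fixed. -/
def anyF {κ : Kind} (f : Any (Arr κ)) : Any (Arr κ) := ⟨f.arr.F⟩

/-- `f ≡ g` iff `F^k f = F^l g` for some `k` and `l`. -/
def StarEq {κ : Kind} (f g : Any (Arr κ)) : Prop :=
  ∃ k l : ℕ, anyF^[k] f = anyF^[l] g

theorem StarEq.equivalence (κ : Kind) : Equivalence (StarEq (κ := κ)) where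
  refl f := ⟨0, 0, rfl⟩
  symm := fun ⟨k, l, h⟩ => ⟨l, k, h.symm⟩
  trans := by
    rintro f g h ⟨k, l, e₁⟩ ⟨p, q, e₂⟩
    refine ⟨p + k, l + q, ?_⟩
    rw [Function.iterate_add_apply, e₁, ← Function.iterate_add_apply, Nat.add_comm p l,
      Function.iterate_add_apply, e₂, ← Function.iterate_add_apply]

/-- `≡` as a setoid. -/
def starSetoid (κ : Kind) : Setoid (Any (Arr κ)) := ⟨StarEq, StarEq.equivalence κ⟩

/-- `h` is the composite `g ∘ f`. -/
inductive IsComp {κ : Kind} : Any (Arr κ) → Any (Arr κ) → Any (Arr κ) → Prop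
  | mk {m n k : ℕ} (g : Arr κ n k) (f : Arr κ m n) : IsComp ⟨g⟩ ⟨f⟩ ⟨g.comp f⟩

section Helpers

variable {κ : Kind}

theorem anyF_iterate {m n : ℕ} (f : Arr κ m n) (j : ℕ) :
    anyF^[j] (⟨f⟩ : Any (Arr κ)) = ⟨shift (Arr κ) Arr.F f j⟩ := by
  induction j with
  | zero => rfl
  | succ j ih => rw [Function.iterate_succ_apply', ih]; rfl

theorem anyF_iterate_dom (f : Any (Arr κ)) (j : ℕ) : (anyF^[j] f).dom = f.dom + j := by
  cases f; rw [anyF_iterate]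

theorem anyF_iterate_cod (f : Any (Arr κ)) (j : ℕ) : (anyF^[j] f).cod = f.cod + j := by
  cases f; rw [anyF_iterate]

theorem IsComp.dom_eq {g f h : Any (Arr κ)} (H : IsComp g f h) : f.cod = g.dom := by
  cases H; rfl

theorem IsComp.anyF_iterate {g f h : Any (Arr κ)} (H : IsComp g f h) (j : ℕ) :
    IsComp (anyF^[j] g) (anyF^[j] f) (anyF^[j] h) := by
  induction j with
  | zero => exact H
  | succ j ih =>
    simp only [Function.iterate_succ_apply']
    generalize anyF^[j] g = g' at ih ⊢
    generalize anyF^[j] f = f' at ih ⊢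
    generalize anyF^[j] h = h' at ih ⊢
    cases ih with
    | mk g f =>
      have := IsComp.mk g.F f.F
      rw [← Arr.F_comp] at this
      exact this

theorem IsComp.unique {g f h h' : Any (Arr κ)} (H : IsComp g f h) (H' : IsComp g f h') :
    h = h' := by
  cases H; cases H'; rfl

theorem isComp_of_eq {m n n' k : ℕ} (g : Arr κ n' k) (f : Arr κ m n) (e : n = n') :
    IsComp ⟨g⟩ ⟨f⟩ ⟨g.comp (e ▸ f)⟩ := by
  subst e; exact IsComp.mk g f

theorem isComp_of_eq' {m n n' k : ℕ} (g : Arr κ n' k) (f : Arr κ m n) (e : n' = n) :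
    IsComp ⟨g⟩ ⟨f⟩ ⟨Arr.comp (e ▸ g) f⟩ := by
  subst e; exact IsComp.mk g f

theorem exists_isComp (g f : Any (Arr κ)) :
    ∃ b a, IsComp (anyF^[b] g) (anyF^[a] f) (arrStar g f) := by
  obtain @⟨k, l, g⟩ := g
  obtain @⟨m, n, f⟩ := f
  unfold arrStar starOf
  split
  case isTrue h =>
    refine ⟨0, k - n, ?_⟩
    rw [SelfAdj.anyF_iterate f]
    exact isComp_of_eq g _ (Nat.add_sub_of_le h)
  case isFalse h =>
    refine ⟨n - k, 0, ?_⟩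
    rw [SelfAdj.anyF_iterate g]
    exact isComp_of_eq' _ f (Nat.add_sub_of_le (Nat.le_of_not_le h))

theorem IsComp.starEq {g f h h' : Any (Arr κ)} {b a b' a' : ℕ}
    (H : IsComp (anyF^[b] g) (anyF^[a] f) h) (H' : IsComp (anyF^[b'] g) (anyF^[a'] f) h') :
    StarEq h h' := by
  have e := H.dom_eq
  have e' := H'.dom_eq
  rw [anyF_iterate_dom, anyF_iterate_cod] at e e'
  refine ⟨a', a, ?_⟩
  have P := H.anyF_iterate a'
  have P' := H'.anyF_iterate a
  simp only [← Function.iterate_add_apply] at P P'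
  rw [show a + b' = a' + b by omega, show a + a' = a' + a by omega] at P'
  exact P.unique P'

theorem isComp_starEq_arrStar {g f h : Any (Arr κ)} (H : IsComp g f h) :
    StarEq (arrStar g f) h := by
  obtain ⟨b, a, P⟩ := exists_isComp g f
  exact IsComp.starEq (b' := 0) (a' := 0) P H

theorem arrStar_congr {g₁ g₂ f₁ f₂ : Any (Arr κ)} (hg : StarEq g₁ g₂) (hf : StarEq f₁ f₂) :
    StarEq (arrStar g₁ f₁) (arrStar g₂ f₂) := by
  obtain ⟨k, l, eg⟩ := hg
  obtain ⟨p, q, ef⟩ := hf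
  obtain ⟨b₁, a₁, P₁⟩ := exists_isComp g₁ f₁
  obtain ⟨b₂, a₂, P₂⟩ := exists_isComp g₂ f₂
  have Q₁ := P₁.anyF_iterate (k + p)
  have e : ∀ (x : Any (Arr κ)) (i j : ℕ), anyF^[i] (anyF^[j] x) = anyF^[j] (anyF^[i] x) := by
    intro x i j
    rw [← Function.iterate_add_apply, Nat.add_comm, Function.iterate_add_apply]
  have h₁ : anyF^[k + p] (anyF^[b₁] g₁) = anyF^[p + b₁ + l] g₂ := by
    rw [Function.iterate_add_apply _ (p + b₁) l, ← eg]
    simp only [← Function.iterate_add_apply]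
    congr 1; omega
  have h₂ : anyF^[k + p] (anyF^[a₁] f₁) = anyF^[k + a₁ + q] f₂ := by
    rw [Function.iterate_add_apply _ (k + a₁) q, ← ef]
    simp only [← Function.iterate_add_apply]
    congr 1; omega
  rw [h₁, h₂] at Q₁
  exact (StarEq.equivalence κ).trans ⟨k + p, 0, rfl⟩ (Q₁.starEq P₂)

end Helpers

/-- The set `𝓛_c^∗`, `𝓚_c^∗` or `𝓙_c^∗` of classes of arrows. -/
def CStar (κ : Kind) : Type := Quotient (starSetoid κ)

/-- The class `[f]` of an arrow. -/
def CStar.mk {κ : Kind} (f : Any (Arr κ)) : CStar κ := Quotient.mk (starSetoid κ) f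

/-- `𝟏 = [𝟏₀]`. -/
instance (κ : Kind) : One (CStar κ) := ⟨CStar.mk ⟨Arr.one 0⟩⟩

/-- `[g][f] = [g ∗ f]`. -/
instance (κ : Kind) : Mul (CStar κ) :=
  ⟨Quotient.lift₂ (fun g f => CStar.mk (arrStar g f))
    (fun _ _ _ _ hg hf => Quotient.sound (arrStar_congr hg hf))⟩

theorem CStar.mk_mul_mk_of_isComp {κ : Kind} {g f h : Any (Arr κ)} (H : IsComp g f h) :
    CStar.mk g * CStar.mk f = CStar.mk h :=
  Quotient.sound (isComp_starEq_arrStar H)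

theorem CStar.mk_shift {κ : Kind} {m n : ℕ} (f : Arr κ m n) (j : ℕ) :
    CStar.mk ⟨shift (Arr κ) Arr.F f j⟩ = CStar.mk ⟨f⟩ :=
  Quotient.sound ⟨0, j, (anyF_iterate f j).symm⟩

theorem CStar.mk_one {κ : Kind} (n : ℕ) : CStar.mk ⟨Arr.one n⟩ = (1 : CStar κ) := by
  induction n with
  | zero => rfl
  | succ n ih =>
    rw [← ih, ← CStar.mk_shift (Arr.one n) 1]
    exact congrArg (fun x => CStar.mk ⟨x⟩) (Quotient.sound (TermEq.F_one n).symm)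

theorem CStar.exists_rep {κ : Kind} (x : CStar κ) :
    ∃ (m n : ℕ) (f : Arr κ m n), x = CStar.mk ⟨f⟩ := by
  induction x using Quotient.inductionOn with
  | _ f => exact ⟨_, _, f.arr, rfl⟩

theorem CStar.exists_rep_of_le {κ : Kind} {m n m' : ℕ} (f : Arr κ m n) (h : m ≤ m') :
    ∃ (n' : ℕ) (f' : Arr κ m' n'), CStar.mk ⟨f⟩ = CStar.mk ⟨f'⟩ := by
  obtain ⟨j, rfl⟩ := Nat.exists_eq_add_of_le h
  exact ⟨n + j, shift (Arr κ) Arr.F f j, (CStar.mk_shift f j).symm⟩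

theorem CStar.exists_rep_of_cod_le {κ : Kind} {m n n' : ℕ} (f : Arr κ m n) (h : n ≤ n') :
    ∃ (m' : ℕ) (f' : Arr κ m' n'), CStar.mk ⟨f⟩ = CStar.mk ⟨f'⟩ := by
  obtain ⟨j, rfl⟩ := Nat.exists_eq_add_of_le h
  exact ⟨m + j, shift (Arr κ) Arr.F f j, (CStar.mk_shift f j).symm⟩

instance (κ : Kind) : Monoid (CStar κ) where
  one_mul x := by
    obtain ⟨m, n, f, rfl⟩ := x.exists_rep
    rw [← CStar.mk_one n, CStar.mk_mul_mk_of_isComp (IsComp.mk _ f), Arr.one_comp]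
  mul_one x := by
    obtain ⟨m, n, f, rfl⟩ := x.exists_rep
    rw [← CStar.mk_one m, CStar.mk_mul_mk_of_isComp (IsComp.mk f _), Arr.comp_one]
  mul_assoc x y z := by
    obtain ⟨n₀, p₀, h₀, rfl⟩ := x.exists_rep
    obtain ⟨m₀, n₁, g₀, rfl⟩ := y.exists_rep
    obtain ⟨l₀, m₁, f₀, rfl⟩ := z.exists_rep
    obtain ⟨l, f, ef⟩ := CStar.exists_rep_of_cod_le f₀
      (show m₁ ≤ m₀ + (m₁ + n₀) by omega)
    obtain ⟨p, h, eh⟩ := CStar.exists_rep_of_le h₀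
      (show n₀ ≤ n₁ + (m₁ + n₀) by omega)
    rw [ef, eh, ← CStar.mk_shift g₀ (m₁ + n₀),
      CStar.mk_mul_mk_of_isComp (IsComp.mk h _),
      CStar.mk_mul_mk_of_isComp (IsComp.mk _ f),
      CStar.mk_mul_mk_of_isComp (IsComp.mk _ f),
      CStar.mk_mul_mk_of_isComp (IsComp.mk h _), Arr.assoc]

/-- The map `ψ` from arrow-terms to terms. -/
def psi {m n : ℕ} : ArrowTerm m n → Term
  | .one _ => .one
  | .phi n => .cup n.succPNat
  | .gam n => .cap n.succPNat
  | .F f => psi f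
  | .comp g f => .mul (psi g) (psi f)

/-- The map `χ` from terms to arrow-terms. -/
def chi : Term → Any ArrowTerm
  | .one => ⟨.one 0⟩
  | .cup k => ⟨.phi k.natPred⟩
  | .cap k => ⟨.gam k.natPred⟩
  | .mul t u => termStar (chi t) (chi u)

/-- The class in `𝓛_c^∗`, `𝓚_c^∗` or `𝓙_c^∗` of an arrow-term. -/
def starClass (κ : Kind) (f : Any ArrowTerm) : CStar κ := CStar.mk ⟨f.arr.toArr κ⟩

/-- The generators of `𝓚_n` and `𝓙_n`: the diapsides `h_i` for `1 ≤ i ≤ n - 1`, and the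
circle `c`. -/
inductive DGen (n : ℕ)
  | h (i : ℕ) (one_le : 1 ≤ i) (lt : i < n)
  | c

/-- The diapsis `h_i` as a word. -/
def wh {n : ℕ} (i : ℕ) (h₁ : 1 ≤ i) (h₂ : i < n) : FreeMonoid (DGen n) :=
  FreeMonoid.of (DGen.h i h₁ h₂)

/-- The circle as a word. -/
def wc {n : ℕ} : FreeMonoid (DGen n) := FreeMonoid.of DGen.c

/-- The defining equations of `𝓚_n`. -/
inductive KnRel (n : ℕ) : FreeMonoid (DGen n) → FreeMonoid (DGen n) → Prop
  | h_comm (i j : ℕ) (hi : 1 ≤ i) (hi' : i < n) (hj : 1 ≤ j + 2) (hj' : j + 2 < n)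
      (hij : i ≤ j) :
      KnRel n (wh i hi hi' * wh (j + 2) hj hj') (wh (j + 2) hj hj' * wh i hi hi')
  | h_braid (i j : ℕ) (hi : 1 ≤ i) (hi' : i < n) (hj : 1 ≤ j) (hj' : j < n)
      (hij : j = i + 1 ∨ i = j + 1) :
      KnRel n (wh i hi hi' * wh j hj hj' * wh i hi hi') (wh i hi hi')
  | h_c (i : ℕ) (hi : 1 ≤ i) (hi' : i < n) :
      KnRel n (wh i hi hi' * wc) (wc * wh i hi hi')
  | h_h (i : ℕ) (hi : 1 ≤ i) (hi' : i < n) :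
      KnRel n (wh i hi hi' * wh i hi hi') (wc * wh i hi hi')

/-- The defining equations of `𝓙_n`: those of `𝓚_n` and `c = 𝟏`. -/
inductive JnRel (n : ℕ) : FreeMonoid (DGen n) → FreeMonoid (DGen n) → Prop
  | of_K {t u : FreeMonoid (DGen n)} (h : KnRel n t u) : JnRel n t u
  | c_eq_one : JnRel n wc 1

/-- The monoid `𝓚_n`. -/
abbrev Kn (n : ℕ) : Type := PresentedMonoid (KnRel n)

/-- The monoid `𝓙_n`. -/
abbrev Jn (n : ℕ) : Type := PresentedMonoid (JnRel n)

/-- The endomorphism `κ_n = φ_n ∘ γ_n` of `n`. -/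
def kap (κ : Kind) (n : ℕ) : End (⟨n⟩ : FreeCat κ) := (Arr.phi n).comp (Arr.gam n)

/-- The arrow `F^(n-i-1) (γ_(i-1) ∘ φ_(i-1))`, which for `1 ≤ i < n` is an endomorphism of `n`. -/
def diapArr (κ : Kind) (n i : ℕ) : Any (Arr κ) :=
  anyF^[n - i - 1] ⟨(Arr.gam (i - 1)).comp (Arr.phi (i - 1))⟩

end SelfAdj

open SelfAdj

/-! `ψ` erases `F`, and `≡` identifies `f` with `F f`. Under this identification the naturality
squares of `φ` and `γ` become the commutation relations of `Omega κ`, the triangles become the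
relations `⌊k⌋⌈k±1⌉ = 𝟏`, and the extra equations of `𝓚` and `𝓙` match. Hence `ψ` respects equality
(`eval_psi_eq`) and `χ` respects the relations (`genClass_rel`). The two are mutually inverse by
`psi_chi` and `chiHom_eval_psi`.

Cancellation holds because naturality rewrites `F (F f) ∘ γ` as `γ ∘ f`, and any left inverse of `γ`
then recovers `f`. A triangle gives one when the target is an `F b` (dually for the source), and in
`𝓙` the counit is one. In `𝓚_c` this leaves the endomorphisms of `0`, which are powers of the
circle. Cancellation turns `≡` into equality.

For the endomorphism monoids, every endomorphism is a product of diapsides and circles (`Arr.diap`):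
an arrow can be arranged to use only units or only counits, and an endomorphism then uses neither.
Injectivity compares Jones normal forms. The diapsis relations bring every element to `c ^ k` times
a word in normal form (`IsDiapsidal.exists_nf`), and the model `A ↦ A × A` separates these. There an
arrow acts as a matrix indexed by labellings of the strands by two labels, the circle acts as
doubling, and the support of the matrix determines the normal form (`Iter.nf_eq_of_rel`).
Coefficients in `ℕ` also detect `k`, which serves `𝓚`; idempotent coefficients make the circle
trivial, which serves `𝓙`. -/

namespace SelfAdj


/-! ### Equations of arrows -/

namespace Arr

variable {κ : Kind}

theorem F_one (n : ℕ) : F (one n : Arr κ n n) = one (n + 1) :=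
  Quotient.sound (TermEq.F_one n)

theorem nat_phi {m n : ℕ} (f : Arr κ m n) : comp f (phi m) = comp (phi n) (F (F f)) := by
  induction f using Quotient.inductionOn with
  | _ f => exact Quotient.sound (TermEq.nat_phi f)

theorem nat_gam {m n : ℕ} (f : Arr κ m n) : comp (F (F f)) (gam m) = comp (gam n) f := by
  induction f using Quotient.inductionOn with
  | _ f => exact Quotient.sound (TermEq.nat_gam f)

theorem triangle_left (n : ℕ) : comp (F (phi n)) (gam (n + 1)) = (one (n + 1) : Arr κ _ _) :=
  Quotient.sound (TermEq.triangle_left n)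

theorem triangle_right (n : ℕ) : comp (phi (n + 1)) (F (gam n)) = (one (n + 1) : Arr κ _ _) :=
  Quotient.sound (TermEq.triangle_right n)

/-- Naturality turns `F (F f) ∘ γ` into `γ ∘ f`, and a triangle strips the `γ`, so `f` is a function
of `F f`. -/
theorem F_injective_of_cod {m n : ℕ} {f g : Arr κ m (n + 1)} (h : F f = F g) : f = g := by
  have key : ∀ f : Arr κ m (n + 1), f = comp (F (phi n)) (comp (F (F f)) (gam m)) := by
    intro f
    rw [nat_gam, assoc, triangle_left, one_comp]
  rw [key f, h, ← key g]

theorem F_injective_of_dom {m n : ℕ} {f g : Arr κ (m + 1) n} (h : F f = F g) : f = g := by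
  have key : ∀ f : Arr κ (m + 1) n, f = comp (comp (phi n) (F (F f))) (F (gam m)) := by
    intro f
    rw [← nat_phi, ← assoc, triangle_right, comp_one]
  rw [key f, h, ← key g]

theorem F_injective_of_pos {m n : ℕ} (hmn : 0 < m + n) {f g : Arr κ m n} (h : F f = F g) :
    f = g := by
  rcases n with _ | n
  · rcases m with _ | m
    · omega
    · exact F_injective_of_dom h
  · exact F_injective_of_cod h

/-- Here the trivial circle replaces the triangle: `φ` itself undoes `γ`, whatever the type of `f`.
-/
theorem F_injective_J {m n : ℕ} {f g : Arr Kind.J m n} (h : F f = F g) : f = g := by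
  have key : ∀ f : Arr Kind.J m n, f = comp (phi n) (comp (F (F f)) (gam m)) := by
    intro f
    rw [nat_gam, assoc, show comp (phi n) (gam n) = (one n : Arr Kind.J n n) from
      Quotient.sound (TermEq.phi_gam_J rfl n), one_comp]
  rw [key f, h, ← key g]

end Arr

/-- Comparing sources forces `k = l`, so for parallel arrows `≡` reduces to cancelling `F` one layer
at a time. -/
theorem eq_of_starEq {κ : Kind} {m n : ℕ}
    (hF : ∀ (j : ℕ) (f g : Arr κ (m + j) (n + j)), f.F = g.F → f = g)
    {f g : Arr κ m n} (h : StarEq (⟨f⟩ : Any (Arr κ)) ⟨g⟩) : f = g := by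
  obtain ⟨k, l, h⟩ := h
  have hkl : k = l := by
    have := congrArg Any.dom h
    rw [anyF_iterate_dom, anyF_iterate_dom] at this
    exact Nat.add_left_cancel this
  subst hkl
  rw [anyF_iterate, anyF_iterate] at h
  have h' : shift (Arr κ) Arr.F f k = shift (Arr κ) Arr.F g k := by
    injection h with _ _ h
  clear h
  induction k with
  | zero => exact h'
  | succ k ih => exact ih (hF k _ _ h')

/-! ### The maps `ψ` and `χ` -/

section Psi

variable {κ : Kind}

theorem omega_rel {x y : FreeMonoid Gen} (h : OmegaRel κ x y) :
    PresentedMonoid.mk (OmegaRel κ) x = PresentedMonoid.mk (OmegaRel κ) y :=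
  PresentedMonoid.mk_eq_mk_of_rel h

/-- The cup `⌊k⌋` in the monoid. -/
def ocup (κ : Kind) (k : ℕ+) : Omega κ := PresentedMonoid.of (OmegaRel κ) (Gen.cup k)

/-- The cap `⌈k⌉` in the monoid. -/
def ocap (κ : Kind) (k : ℕ+) : Omega κ := PresentedMonoid.of (OmegaRel κ) (Gen.cap k)

/-- At `j = 0` this is naturality of `φ` seen through `ψ`. The offset `j` carries the induction
through `F`: the case of `F f` at `j` is the case of `f` at `j + 1`. -/
theorem eval_psi_mul_ocup {m n : ℕ} (f : ArrowTerm m n) (j : ℕ) :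
    (psi f).eval κ * ocup κ (m + j).succPNat = ocup κ (n + j).succPNat * (psi f).eval κ := by
  induction f generalizing j with
  | one n => simp [psi, Term.eval]
  | phi n =>
    have := omega_rel (OmegaRel.cup_cup (κ := κ) (n + j).succPNat n.succPNat
      (Nat.succPNat_le_succPNat.2 (Nat.le_add_right n j)))
    rw [show (n + j).succPNat + 2 = (n + 2 + j).succPNat from PNat.eq (by simp; omega)] at this
    exact this.symm
  | gam n =>
    have := omega_rel (OmegaRel.cup_cap_two (κ := κ) (n + j).succPNat n.succPNat
      (Nat.succPNat_le_succPNat.2 (Nat.le_add_right n j)))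
    rw [show (n + j).succPNat + 2 = (n + 2 + j).succPNat from PNat.eq (by simp; omega)] at this
    exact this.symm
  | F f ih =>
    have := ih (j + 1)
    rwa [← Nat.add_assoc, Nat.add_right_comm, ← Nat.add_assoc, Nat.add_right_comm _ j] at this
  | comp g f ihg ihf => simp only [psi, Term.eval]; rw [mul_assoc, ihf, ← mul_assoc, ihg, mul_assoc]

theorem eval_psi_mul_ocap {m n : ℕ} (f : ArrowTerm m n) (j : ℕ) :
    (psi f).eval κ * ocap κ (m + j).succPNat = ocap κ (n + j).succPNat * (psi f).eval κ := by
  induction f generalizing j with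
  | one n => simp [psi, Term.eval]
  | phi n =>
    have := omega_rel (OmegaRel.cup_cap_one (κ := κ) (n + j).succPNat n.succPNat
      (Nat.succPNat_le_succPNat.2 (Nat.le_add_right n j)))
    rw [show (n + j).succPNat + 2 = (n + 2 + j).succPNat from PNat.eq (by simp; omega)] at this
    exact this
  | gam n =>
    have := omega_rel (OmegaRel.cap_cap (κ := κ) (n + j).succPNat n.succPNat
      (Nat.succPNat_le_succPNat.2 (Nat.le_add_right n j)))
    rw [show (n + j).succPNat + 2 = (n + 2 + j).succPNat from PNat.eq (by simp; omega)] at this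
    exact this
  | F f ih =>
    have := ih (j + 1)
    rwa [← Nat.add_assoc, Nat.add_right_comm, ← Nat.add_assoc, Nat.add_right_comm _ j] at this
  | comp g f ihg ihf => simp only [psi, Term.eval]; rw [mul_assoc, ihf, ← mul_assoc, ihg, mul_assoc]

theorem eval_psi_eq {m n : ℕ} {f g : ArrowTerm m n} (h : TermEq κ f g) :
    (psi f).eval κ = (psi g).eval κ := by
  induction h with
  | refl f => rfl
  | symm _ ih => exact ih.symm
  | trans _ _ ih₁ ih₂ => exact ih₁.trans ih₂
  | congr_F _ ih => exact ih
  | congr_comp _ _ ihf ihg => simp only [psi, Term.eval]; rw [ihf, ihg]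
  | comp_one f => exact mul_one _
  | one_comp f => exact one_mul _
  | assoc h g f => exact (mul_assoc _ _ _).symm
  | F_one n => rfl
  | F_comp g f => rfl
  | nat_phi f => exact eval_psi_mul_ocup f 0
  | nat_gam f => exact eval_psi_mul_ocap f 0
  | triangle_left n => exact omega_rel (OmegaRel.cup_cap_three_add n.succPNat)
  | triangle_right n => exact omega_rel (OmegaRel.cup_cap_three_sub n.succPNat)
  | phi_gam_K hκ n => exact omega_rel (OmegaRel.cup_cap_four hκ n.succPNat)
  | phi_gam_J hκ n => exact omega_rel (OmegaRel.circle hκ n.succPNat)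

/-- The map induced by `ψ` on arrows. -/
def arrEval {m n : ℕ} : Arr κ m n → Omega κ :=
  Quotient.lift (fun f => (psi f).eval κ) (fun _ _ h => eval_psi_eq h)

theorem arrEval_F {m n : ℕ} (f : Arr κ m n) : arrEval f.F = arrEval f := by
  induction f using Quotient.inductionOn with
  | _ f => rfl

/-- The map induced by `ψ` on classes of arrows. -/
def starEval : CStar κ → Omega κ :=
  Quotient.lift (fun f : Any (Arr κ) => arrEval f.arr) (by
    have key : ∀ (k : ℕ) (f : Any (Arr κ)), arrEval (anyF^[k] f).arr = arrEval f.arr := by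
      intro k f
      induction k with
      | zero => rfl
      | succ k ih =>
        rw [Function.iterate_succ_apply', ← ih]
        exact arrEval_F _
    rintro f g ⟨k, l, h⟩
    rw [← key k f, h, key l g])

theorem CStar.mk_F {m n : ℕ} (f : Arr κ m n) :
    (CStar.mk ⟨f.F⟩ : CStar κ) = CStar.mk ⟨f⟩ :=
  CStar.mk_shift f 1

theorem CStar.mk_comp {m n k : ℕ} (g : Arr κ n k) (f : Arr κ m n) :
    (CStar.mk ⟨g.comp f⟩ : CStar κ) = CStar.mk ⟨g⟩ * CStar.mk ⟨f⟩ :=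
  (CStar.mk_mul_mk_of_isComp (IsComp.mk g f)).symm

/-- The class of `φ_n`. -/
def phiClass (κ : Kind) (n : ℕ) : CStar κ := CStar.mk ⟨Arr.phi n⟩

/-- The class of `γ_n`. -/
def gamClass (κ : Kind) (n : ℕ) : CStar κ := CStar.mk ⟨Arr.gam n⟩

/-- Naturality of `φ` at `F^j f`; the class does not see the `F^j`. -/
theorem CStar.mk_mul_phiClass {m n : ℕ} (f : Arr κ m n) (j : ℕ) :
    CStar.mk ⟨f⟩ * phiClass κ (m + j) = phiClass κ (n + j) * CStar.mk ⟨f⟩ := by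
  have h := Arr.nat_phi (shift (Arr κ) Arr.F f j)
  have h' := congrArg (fun x => (CStar.mk ⟨x⟩ : CStar κ)) h
  simp only [CStar.mk_comp, CStar.mk_F, CStar.mk_shift] at h'
  exact h'

theorem CStar.mk_mul_gamClass {m n : ℕ} (f : Arr κ m n) (j : ℕ) :
    CStar.mk ⟨f⟩ * gamClass κ (m + j) = gamClass κ (n + j) * CStar.mk ⟨f⟩ := by
  have h := Arr.nat_gam (shift (Arr κ) Arr.F f j)
  have h' := congrArg (fun x => (CStar.mk ⟨x⟩ : CStar κ)) h
  simp only [CStar.mk_comp, CStar.mk_F, CStar.mk_shift] at h'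
  exact h'

theorem phiClass_mul_gamClass_add_one (n : ℕ) : phiClass κ n * gamClass κ (n + 1) = 1 := by
  rw [phiClass, gamClass, ← CStar.mk_F (Arr.phi n), ← CStar.mk_comp, Arr.triangle_left,
    CStar.mk_one]

theorem phiClass_add_one_mul_gamClass (n : ℕ) : phiClass κ (n + 1) * gamClass κ n = 1 := by
  rw [phiClass, gamClass, ← CStar.mk_F (Arr.gam n), ← CStar.mk_comp, Arr.triangle_right,
    CStar.mk_one]

theorem phiClass_mul_gamClass_of_K (hκ : κ = Kind.K) (n : ℕ) :
    phiClass κ n * gamClass κ n = phiClass κ (n + 1) * gamClass κ (n + 1) := by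
  simp only [phiClass, gamClass, ← CStar.mk_comp]
  rw [← CStar.mk_F]
  exact congrArg (fun x => (CStar.mk ⟨x⟩ : CStar κ)) (Quotient.sound (TermEq.phi_gam_K hκ n))

theorem phiClass_mul_gamClass_of_J (hκ : κ = Kind.J) (n : ℕ) :
    phiClass κ n * gamClass κ n = 1 := by
  rw [phiClass, gamClass, ← CStar.mk_comp, ← CStar.mk_one n]
  exact congrArg (fun x => (CStar.mk ⟨x⟩ : CStar κ)) (Quotient.sound (TermEq.phi_gam_J hκ n))

/-- The images of the generators under `χ`. -/
def genClass (κ : Kind) : Gen → CStar κ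
  | .cup k => phiClass κ k.natPred
  | .cap k => gamClass κ k.natPred

/-- The difference `j = k - l` is the number of times `F` must be applied before naturality gives
the relation for `k` and `l`. -/
theorem exists_natPred_add {k l : ℕ+} (h : l ≤ k) :
    ∃ i j : ℕ, l.natPred = i ∧ k.natPred = i + j ∧ (k + 2).natPred = i + 2 + j := by
  have h' : (l : ℕ) ≤ k := h
  have hl := l.pos
  refine ⟨l.natPred, k - l, rfl, ?_, ?_⟩ <;> simp [PNat.natPred] <;> omega

theorem natPred_add_one (k : ℕ+) : (k + 1).natPred = k.natPred + 1 := by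
  have := k.pos
  simp [PNat.natPred]; omega

/-- The four commutation relations are naturality of `φ` and `γ` with respect to shifts of `φ_i` and
`γ_i` themselves. -/
theorem genClass_rel {x y : FreeMonoid Gen} (h : OmegaRel κ x y) :
    FreeMonoid.lift (genClass κ) x = FreeMonoid.lift (genClass κ) y := by
  cases h with
  | cup_cup k l h =>
    obtain ⟨i, j, h₁, h₂, h₃⟩ := exists_natPred_add h
    simp only [map_mul, wcup, FreeMonoid.lift_eval_of, genClass, h₁, h₂, h₃]
    exact (CStar.mk_mul_phiClass (Arr.phi i) j).symm
  | cap_cap k l h =>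
    obtain ⟨i, j, h₁, h₂, h₃⟩ := exists_natPred_add h
    simp only [map_mul, wcap, FreeMonoid.lift_eval_of, genClass, h₁, h₂, h₃]
    exact CStar.mk_mul_gamClass (Arr.gam i) j
  | cup_cap_one k l h =>
    obtain ⟨i, j, h₁, h₂, h₃⟩ := exists_natPred_add h
    simp only [map_mul, wcup, wcap, FreeMonoid.lift_eval_of, genClass, h₁, h₂, h₃]
    exact CStar.mk_mul_gamClass (Arr.phi i) j
  | cup_cap_two k l h =>
    obtain ⟨i, j, h₁, h₂, h₃⟩ := exists_natPred_add h
    simp only [map_mul, wcup, wcap, FreeMonoid.lift_eval_of, genClass, h₁, h₂, h₃]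
    exact (CStar.mk_mul_phiClass (Arr.gam i) j).symm
  | cup_cap_three_add k =>
    simp only [map_mul, map_one, wcup, wcap, FreeMonoid.lift_eval_of, genClass, natPred_add_one]
    exact phiClass_mul_gamClass_add_one _
  | cup_cap_three_sub k =>
    simp only [map_mul, map_one, wcup, wcap, FreeMonoid.lift_eval_of, genClass, natPred_add_one]
    exact phiClass_add_one_mul_gamClass _
  | cup_cap_four hκ k =>
    simp only [map_mul, wcup, wcap, FreeMonoid.lift_eval_of, genClass, natPred_add_one]
    exact phiClass_mul_gamClass_of_K hκ _
  | circle hκ k =>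
    simp only [map_mul, map_one, wcup, wcap, FreeMonoid.lift_eval_of, genClass]
    exact phiClass_mul_gamClass_of_J hκ _

/-- The homomorphism induced by `χ`. -/
def chiHom (κ : Kind) : Omega κ →* CStar κ :=
  PresentedMonoid.lift (genClass κ) (fun _ _ h => genClass_rel h)

theorem chiHom_eval_psi {m n : ℕ} (f : ArrowTerm m n) :
    chiHom κ ((psi f).eval κ) = CStar.mk ⟨f.toArr κ⟩ := by
  induction f with
  | one n => exact (map_one _).trans (CStar.mk_one n).symm
  | phi n =>
    simp only [psi, Term.eval, chiHom, PresentedMonoid.lift_of, genClass, Nat.natPred_succPNat]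
    rfl
  | gam n =>
    simp only [psi, Term.eval, chiHom, PresentedMonoid.lift_of, genClass, Nat.natPred_succPNat]
    rfl
  | F f ih => exact ih.trans (CStar.mk_F (f.toArr κ)).symm
  | comp g f ihg ihf =>
    simp only [psi, Term.eval, map_mul]
    rw [ihg, ihf]
    exact (CStar.mk_comp (g.toArr κ) (f.toArr κ)).symm

theorem starEval_mk {m n : ℕ} (f : ArrowTerm m n) :
    starEval (CStar.mk ⟨f.toArr κ⟩) = (psi f).eval κ := rfl

theorem psi_shift {m n : ℕ} (f : ArrowTerm m n) (j : ℕ) :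
    psi (shift ArrowTerm ArrowTerm.F f j) = psi f := by
  induction j with
  | zero => rfl
  | succ j ih => exact ih

theorem psi_cast_cod {m n n' : ℕ} (e : n = n') (f : ArrowTerm m n) :
    psi (e ▸ f : ArrowTerm m n') = psi f := by
  subst e; rfl

theorem psi_cast_dom {m m' n : ℕ} (e : m = m') (f : ArrowTerm m n) :
    psi (e ▸ f : ArrowTerm m' n) = psi f := by
  subst e; rfl

/-- The copies of `F` that `∗` inserts to match types are erased by `ψ`, so the equality is
syntactic. -/
theorem psi_termStar (g f : Any ArrowTerm) :
    psi (termStar g f).arr = .mul (psi g.arr) (psi f.arr) := by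
  have key : ∀ x : Any ArrowTerm, termStar g f = x → psi x.arr = .mul (psi g.arr) (psi f.arr) := by
    intro x hx
    unfold termStar starOf at hx
    split at hx <;> subst hx
    · simp only [psi, psi_cast_cod, psi_shift]
    · simp only [psi, psi_cast_dom, psi_shift]
  exact key _ rfl

theorem psi_chi (t : Term) : psi (chi t).arr = t := by
  induction t with
  | one => rfl
  | cup k => simp [chi, psi]
  | cap k => simp [chi, psi]
  | mul t u iht ihu => rw [chi, psi_termStar, iht, ihu]

theorem chiHom_eval (t : Term) : chiHom κ (t.eval κ) = starClass κ (chi t) := by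
  conv_lhs => rw [← psi_chi t]
  exact chiHom_eval_psi _

/-- The isomorphism induced by `ψ`. -/
def starEquiv (κ : Kind) : CStar κ ≃* Omega κ :=
  -- The construction goes from the `χ` side, where multiplicativity comes from the presentation;
  -- `ψ` then only has to be an inverse function.
  MulEquiv.symm
    { chiHom κ with
      invFun := starEval
      left_inv := by
        intro x
        have h : ∀ x : Omega κ, ∃ t : Term, t.eval κ = x := by
          intro x
          induction x using PresentedMonoid.inductionOn with
          | _ w =>
            induction w using FreeMonoid.inductionOn' with
            | one => exact ⟨.one, rfl⟩
            | of_mul g w ih =>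
              obtain ⟨t, ht⟩ := ih
              cases g with
              | cup k => exact ⟨.mul (.cup k) t, by rw [Term.eval, ht]; rfl⟩
              | cap k => exact ⟨.mul (.cap k) t, by rw [Term.eval, ht]; rfl⟩
        obtain ⟨t, rfl⟩ := h x
        change starEval (chiHom κ (t.eval κ)) = _
        rw [chiHom_eval, starClass, starEval_mk, psi_chi]
      right_inv := by
        intro x
        induction x using Quotient.inductionOn with
        | _ f =>
          obtain @⟨m, n, f⟩ := f
          induction f using Quotient.inductionOn with
          | _ f => exact chiHom_eval_psi f }

theorem starEquiv_starClass {m n : ℕ} (f : ArrowTerm m n) :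
    starEquiv κ (starClass κ ⟨f⟩) = (psi f).eval κ := rfl

theorem starEquiv_symm_eval (t : Term) :
    (starEquiv κ).symm (t.eval κ) = starClass κ (chi t) := chiHom_eval t

theorem starEq_iff {m n k l : ℕ} (f : ArrowTerm m n) (g : ArrowTerm k l) :
    StarEq (κ := κ) ⟨f.toArr κ⟩ ⟨g.toArr κ⟩ ↔ (psi f).eval κ = (psi g).eval κ := by
  rw [← starEquiv_starClass, ← starEquiv_starClass, (starEquiv κ).injective.eq_iff]
  exact (Quotient.eq (r := starSetoid κ)).symm

end Psi

/-! ### Cancellation in self-adjunctions -/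

section Cancellation

variable {A : Type u} [Category.{v} A] {F : A ⥤ A}

/-- The transpose of `f` is `F f` followed by the counit, hence depends on `F f` alone. -/
theorem map_injective_of_cod (adj : F ⊣ F) {a b : A} {f g : a ⟶ F.obj b}
    (h : F.map f = F.map g) : f = g :=
  (adj.homEquiv a b).symm.injective (by simp only [Adjunction.homEquiv_counit, h])

theorem map_injective_of_dom (adj : F ⊣ F) {a b : A} {f g : F.obj a ⟶ b}
    (h : F.map f = F.map g) : f = g :=
  (adj.homEquiv a b).injective (by simp only [Adjunction.homEquiv_unit, h])

theorem map_injective_of_circle (adj : F ⊣ F)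
    (hc : ∀ a : A, adj.unit.app a ≫ adj.counit.app a = 𝟙 a)
    {a b : A} {f g : a ⟶ b} (h : F.map f = F.map g) : f = g := by
  have key : ∀ f : a ⟶ b,
      f = adj.unit.app a ≫ F.map (F.map f) ≫ adj.counit.app b := by
    intro f
    have := adj.counit.naturality f
    simp only [Functor.comp_map, Functor.id_map] at this
    rw [this, ← Category.assoc, hc]
    exact (Category.id_comp f).symm
  rw [key f, h, ← key g]

end Cancellation


/-! ### Normal forms of words in diapsides -/

/-- The word `t - 1, t - 2, …, a`. -/
def blk (t a : ℕ) : List ℕ := (List.range' a (t - a)).reverse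

theorem mem_blk {t a i : ℕ} : i ∈ blk t a ↔ a ≤ i ∧ i < t := by
  simp only [blk, List.mem_reverse, List.mem_range'_1]
  omega

theorem blk_split {t k a : ℕ} (h₁ : a ≤ k) (h₂ : k ≤ t) : blk t a = blk t k ++ blk k a := by
  obtain ⟨i, rfl⟩ := Nat.exists_eq_add_of_le h₁
  obtain ⟨j, rfl⟩ := Nat.exists_eq_add_of_le h₂
  simp only [blk]
  rw [← List.reverse_append, show a + i - a = i by omega, show a + i + j - (a + i) = j by omega,
    show a + i + j - a = i + j by omega, List.range'_append_1]

theorem blk_self (a : ℕ) : blk a a = [] := by simp [blk]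

theorem blk_succ_self (a : ℕ) : blk (a + 1) a = [a] := by simp [blk]

theorem blk_succ {t a : ℕ} (h : a ≤ t) : blk (t + 1) a = t :: blk t a := by
  rw [blk_split h (Nat.le_succ t), blk_succ_self]; rfl

/-- The words over the letters `0, …, m - 1` in Jones normal form, all of whose blocks end in
a letter less than `p`. -/
inductive NF : ℕ → ℕ → List ℕ → Prop
  | nil (p : ℕ) : NF 0 p []
  | skip {m p : ℕ} {u : List ℕ} : NF m p u → NF (m + 1) p u
  | block {m p a : ℕ} {u : List ℕ} : NF m a u → a ≤ m → a < p → NF (m + 1) p (u ++ blk (m + 1) a)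

namespace NF

theorem lt_of_mem {m p : ℕ} {u : List ℕ} (h : NF m p u) : ∀ i ∈ u, i < m := by
  induction h with
  | nil p => simp
  | skip _ ih => exact fun i hi => (ih i hi).trans (Nat.lt_succ_self _)
  | block _ _ _ ih =>
    intro i hi
    rcases List.mem_append.1 hi with hi | hi
    · exact (ih i hi).trans (Nat.lt_succ_self _)
    · exact (mem_blk.1 hi).2

theorem mono {m p q : ℕ} {u : List ℕ} (h : NF m p u) (hpq : p ≤ q) : NF m q u := by
  induction h with
  | nil p => exact nil q
  | skip _ ih => exact skip (ih hpq)
  | block h h₁ h₂ ih => exact block h h₁ (h₂.trans_le hpq)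

theorem lift {m m' p : ℕ} {u : List ℕ} (h : NF m p u) (hm : m ≤ m') : NF m' p u := by
  obtain ⟨j, rfl⟩ := Nat.exists_eq_add_of_le hm
  clear hm
  induction j with
  | zero => exact h
  | succ j ih => exact skip ih

end NF

/-- The value of a word. -/
def ev {M : Type*} [Monoid M] (h : ℕ → M) (w : List ℕ) : M := (w.map h).prod

section ev

variable {M : Type*} [Monoid M] (h : ℕ → M)

@[simp] theorem ev_nil : ev h [] = 1 := rfl

@[simp] theorem ev_cons (i : ℕ) (w : List ℕ) : ev h (i :: w) = h i * ev h w := by simp [ev]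

@[simp] theorem ev_append (w w' : List ℕ) : ev h (w ++ w') = ev h w * ev h w' := by simp [ev]

theorem ev_singleton (i : ℕ) : ev h [i] = h i := by simp

end ev

/-- The diapsis equations for `h 0, …, h (N - 1)` and the circle `c`. -/
structure IsDiapsidal {M : Type*} [Monoid M] (N : ℕ) (h : ℕ → M) (c : M) : Prop where
  comm (i j : ℕ) : i + 2 ≤ j → j < N → h i * h j = h j * h i
  braid_up (i : ℕ) : i + 1 < N → h i * h (i + 1) * h i = h i
  braid_down (i : ℕ) : i + 1 < N → h (i + 1) * h i * h (i + 1) = h (i + 1)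
  h_c (i : ℕ) : i < N → h i * c = c * h i
  h_h (i : ℕ) : i < N → h i * h i = c * h i

namespace IsDiapsidal

variable {M : Type*} [Monoid M] {N : ℕ} {h : ℕ → M} {c : M}

theorem commute_ev {x : M} {w : List ℕ} (hx : ∀ i ∈ w, Commute x (h i)) : Commute x (ev h w) := by
  induction w with
  | nil => exact Commute.one_right x
  | cons i w ih =>
    rw [ev_cons]
    exact (hx i (by simp)).mul_right (ih fun j hj => hx j (by simp [hj]))

/-! ### Rewriting words to Jones normal form -/

theorem commute_far (H : IsDiapsidal N h c) {i t a : ℕ} (hi : i < N) (ht : t ≤ N)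
    (hf : i + 2 ≤ a ∨ t + 1 ≤ i) : Commute (h i) (ev h (blk t a)) := by
  apply commute_ev
  intro j hj
  rw [mem_blk] at hj
  rcases hf with hf | hf
  · exact H.comm i j (by omega) (by omega)
  · exact (H.comm j i (by omega) hi).symm

theorem commute_blk (H : IsDiapsidal N h c) {t a s b : ℕ} (hs : s ≤ N) (ht : t ≤ N)
    (hf : t + 1 ≤ b) : Commute (ev h (blk t a)) (ev h (blk s b)) := by
  apply commute_ev
  intro j hj
  rw [mem_blk] at hj
  exact (H.commute_far (by omega) ht (Or.inr (by omega))).symm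

theorem commute_c (H : IsDiapsidal N h c) {w : List ℕ} (hw : ∀ i ∈ w, i < N) :
    Commute c (ev h w) :=
  commute_ev fun i hi => (H.h_c i (hw i hi)).symm

/-- The letter `a'` commutes down to the `a' + 1` of the second block, and `h a' * h (a' + 1) * h
a'` collapses to `h a'`. The first block thereby inherits the end `a`, and the second is cut off at
`a' + 2`. -/
theorem straighten (H : IsDiapsidal N h c) {a a' t : ℕ} (d : ℕ) (h₁ : a ≤ a') (h₂ : a' + d < t)
    (ht : t < N) :
    ev h (blk (a' + d + 1) a') * ev h (blk (t + 1) a) =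
      ev h (blk (a' + d + 1) a) * ev h (blk (t + 1) (a' + 2)) := by
  induction d with
  | zero =>
    rw [Nat.add_zero, blk_succ_self, ev_singleton,
      blk_split (show a ≤ a' + 2 by omega) (show a' + 2 ≤ t + 1 by omega),
      blk_succ (show a ≤ a' + 1 by omega), blk_succ h₁]
    simp only [ev_append, ev_cons]
    have h₃ : Commute (h a') (ev h (blk (t + 1) (a' + 2))) :=
      H.commute_far (by omega) (by omega) (Or.inl le_rfl)
    have h₄ : Commute (ev h (blk a' a)) (ev h (blk (t + 1) (a' + 2))) :=
      H.commute_blk (by omega) (by omega) (by omega)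
    generalize ev h (blk (t + 1) (a' + 2)) = x at h₃ h₄ ⊢
    generalize ev h (blk a' a) = y at h₄ ⊢
    rw [← mul_assoc (h a') x, h₃.eq, mul_assoc (h a') y, h₄.eq, ← mul_assoc (h a') x, h₃.eq,
      mul_assoc, mul_assoc, ← mul_assoc (h (a' + 1)), ← mul_assoc (h a'), ← mul_assoc (h a'),
      H.braid_up a' (by omega)]
  | succ d ih =>
    rw [blk_succ (show a' ≤ a' + (d + 1) by omega), blk_succ (show a ≤ a' + (d + 1) by omega),
      ev_cons, ev_cons, mul_assoc, mul_assoc]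
    exact congrArg _ (ih (by omega))

/-- Ends of blocks must increase. If the last block of `u` ends too high, `straighten` passes `a`
down to a shorter word and leaves a block ending in `a' + 2`; hence the bound `p + 2`. -/
theorem exists_nf_mul_blk (H : IsDiapsidal N h c) {m p : ℕ} {u : List ℕ} (hu : NF m p u)
    {t a : ℕ} (hm : m ≤ t) (ha : a ≤ t) (ht : t < N) :
    ∃ v, NF (t + 1) (max (a + 1) (p + 2)) v ∧ ev h u * ev h (blk (t + 1) a) = ev h v := by
  induction hu generalizing t a with
  | nil p =>
    refine ⟨_, NF.block (((NF.nil a).lift (Nat.zero_le t))) ha ?_, ?_⟩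
    · omega
    · simp
  | skip hu ih => exact ih (by omega) ha ht
  | @block m p a' u hu h₁ h₂ ih =>
    by_cases haa : a' < a
    · refine ⟨_, NF.block ((NF.block hu h₁ haa).lift hm) ha (by omega), ?_⟩
      rw [ev_append h (u ++ _)]
    · obtain ⟨d, rfl⟩ := Nat.exists_eq_add_of_le h₁
      obtain ⟨v, hv, e⟩ := ih (t := a' + d) (a := a) le_rfl (by omega) (by omega)
      rw [ev_append, mul_assoc, H.straighten d (by omega) (by omega) ht, ← mul_assoc, e]
      rw [max_eq_right (by omega)] at hv
      by_cases hat : a' + 2 ≤ t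
      · exact ⟨_, NF.block (hv.lift hm) hat (by omega), (ev_append h _ _).symm⟩
      -- Here `a' + 2 = t + 1`, so the remaining block is empty.
      · refine ⟨v, (hv.lift (by omega)).mono (by omega), ?_⟩
        rw [show a' + 2 = t + 1 by omega, blk_self, ev_nil, mul_one]

/-- The largest letter is needed at most once, in one final descending block; the rest is left to
induction on the number of letters. -/
theorem exists_blk (H : IsDiapsidal N h c) {m : ℕ} (hm : m < N) (w : List ℕ)
    (hw : ∀ i ∈ w, i < m + 1) :
    ∃ (k : ℕ) (u : List ℕ) (a : ℕ), (∀ i ∈ u, i < m) ∧ a ≤ m + 1 ∧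
      ev h w = c ^ k * (ev h u * ev h (blk (m + 1) a)) := by
  induction w using List.reverseRecOn with
  -- The end `m + 1` encodes the empty block.
  | nil => exact ⟨0, [], m + 1, by simp, le_rfl, by simp [blk_self]⟩
  | append_singleton w i ih =>
    obtain ⟨k, u, a, hu, ha, e⟩ := ih fun j hj => hw j (by simp [hj])
    have hi : i < m + 1 := hw i (by simp)
    rw [ev_append, ev_singleton, e]
    -- A new letter below `a - 1` commutes past the block, `a - 1` lengthens it, and `a` releases a
    -- circle. A letter above `a` cuts the block off at that letter by a braid relation and frees
    -- the tail below to move left.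
    rcases lt_trichotomy i a with hia | rfl | hia
    · rcases Nat.lt_or_ge (i + 1) a with h₁ | h₁
      · refine ⟨k, u ++ [i], a, ?_, ha, ?_⟩
        · intro j hj
          rcases List.mem_append.1 hj with hj | hj
          · exact hu j hj
          · rw [List.mem_singleton.1 hj]; omega
        · have := H.commute_far (i := i) (t := m + 1) (a := a) (by omega) (by omega)
            (Or.inl (by omega))
          rw [ev_append, ev_singleton, mul_assoc, mul_assoc, mul_assoc, this.eq]
      · obtain rfl : a = i + 1 := by omega
        refine ⟨k, u, i, hu, by omega, ?_⟩
        rw [blk_split (show i ≤ i + 1 by omega) ha, blk_succ_self, ev_append, ev_singleton]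
        simp only [mul_assoc]
    · refine ⟨k + 1, u, i, hu, ha, ?_⟩
      have hc : Commute c (ev h u * ev h (blk (m + 1) (i + 1))) := by
        rw [← ev_append]
        apply H.commute_c
        intro j hj
        rcases List.mem_append.1 hj with hj | hj
        · exact (hu j hj).trans hm
        · exact (mem_blk.1 hj).2.trans_le hm
      rw [blk_split (show i ≤ i + 1 by omega) hi, blk_succ_self, ev_append, ev_singleton,
        mul_assoc, mul_assoc, mul_assoc, H.h_h i (by omega), ← mul_assoc (ev h u),
        ← mul_assoc _ c, ← hc.eq, pow_succ]
      simp only [mul_assoc]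
    · obtain ⟨i, rfl⟩ : ∃ j, i = j + 1 := ⟨i - 1, by omega⟩
      refine ⟨k, u ++ blk i a, i + 1, ?_, by omega, ?_⟩
      · intro j hj
        rcases List.mem_append.1 hj with hj | hj
        · exact hu j hj
        · have := (mem_blk.1 hj).2
          omega
      · have h₁ : Commute (h (i + 1)) (ev h (blk i a)) :=
          H.commute_far (by omega) (by omega) (Or.inr le_rfl)
        have h₂ : Commute (ev h (blk i a)) (ev h (blk (m + 1) (i + 1))) :=
          H.commute_blk (by omega) (by omega) le_rfl
        rw [ev_append, mul_assoc, mul_assoc, mul_assoc (ev h u) (ev h (blk i a)), h₂.eq,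
          blk_split (show a ≤ i + 1 + 1 by omega) (show i + 1 + 1 ≤ m + 1 by omega),
          blk_split (show i + 1 ≤ i + 1 + 1 by omega) (show i + 1 + 1 ≤ m + 1 by omega),
          blk_succ_self, blk_succ (show a ≤ i + 1 by omega), blk_succ (show a ≤ i by omega)]
        simp only [ev_append, ev_cons, ev_nil, mul_one]
        have h₃ := H.braid_down i (by omega)
        rw [mul_assoc (ev h (blk (m + 1) (i + 1 + 1))), mul_assoc (h (i + 1)), mul_assoc (h i),
          ← h₁.eq, ← mul_assoc (h i), ← mul_assoc (h (i + 1)), ← mul_assoc (h (i + 1)), h₃,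
          mul_assoc (ev h (blk (m + 1) (i + 1 + 1)))]

theorem exists_nf (H : IsDiapsidal N h c) {m : ℕ} (hm : m ≤ N) (w : List ℕ)
    (hw : ∀ i ∈ w, i < m) :
    ∃ (k p : ℕ) (v : List ℕ), NF m p v ∧ ev h w = c ^ k * ev h v := by
  induction m generalizing w with
  | zero =>
    cases w with
    | nil => exact ⟨0, 0, [], NF.nil 0, by simp⟩
    | cons i w => exact absurd (hw i (by simp)) (by omega)
  | succ m ih =>
    obtain ⟨k, u, a, hu, ha, e⟩ := H.exists_blk hm w hw
    obtain ⟨l, p, v, hv, e'⟩ := ih (by omega) u hu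
    rw [e, e', mul_assoc, ← mul_assoc, ← pow_add]
    by_cases ham : a ≤ m
    · obtain ⟨v', hv', e''⟩ := H.exists_nf_mul_blk hv le_rfl ham hm
      exact ⟨_, _, v', hv', by rw [e'']⟩
    · obtain rfl : a = m + 1 := by omega
      exact ⟨k + l, p, v, hv.skip, by rw [blk_self, ev_nil, mul_one]⟩

end IsDiapsidal


/-! ### The model of self-adjunction given by `A ↦ A × A` on commutative monoids -/

/-- The `n`-th iterate of `A ↦ A × A`. -/
def Iter (A : Type) : ℕ → Type
  | 0 => A
  | n + 1 => Iter A n × Iter A n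

instance Iter.addCommMonoid (A : Type) [AddCommMonoid A] : (n : ℕ) → AddCommMonoid (Iter A n)
  | 0 => inferInstanceAs (AddCommMonoid A)
  | n + 1 =>
    letI := Iter.addCommMonoid A n
    inferInstanceAs (AddCommMonoid (Iter A n × Iter A n))

namespace Iter

variable {A : Type} [AddCommMonoid A]

/-- The functor `F` of the model. -/
def F {m n : ℕ} (f : Iter A m →+ Iter A n) : Iter A (m + 1) →+ Iter A (n + 1) :=
  AddMonoidHom.prodMap f f

/-- The counit of the model. -/
def phi (n : ℕ) : Iter A (n + 2) →+ Iter A n where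
  toFun x := x.1.1 + x.2.2
  map_zero' := add_zero (0 : Iter A n)
  map_add' x y := add_add_add_comm x.1.1 y.1.1 x.2.2 y.2.2

/-- The unit of the model. -/
def gam (n : ℕ) : Iter A n →+ Iter A (n + 2) where
  toFun x := ((x, 0), (0, x))
  map_zero' := rfl
  map_add' x y := by
    refine Prod.ext (Prod.ext rfl ?_) (Prod.ext ?_ rfl)
    · exact (add_zero (0 : Iter A n)).symm
    · exact (add_zero (0 : Iter A n)).symm

theorem F_apply {m n : ℕ} (f : Iter A m →+ Iter A n) (x y : Iter A m) :
    F f (x, y) = (f x, f y) := rfl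

theorem F_comp {m n k : ℕ} (g : Iter A n →+ Iter A k) (f : Iter A m →+ Iter A n) :
    F (g.comp f) = (F g).comp (F f) := rfl

theorem triangle_left (n : ℕ) :
    (F (phi n)).comp (gam (n + 1)) = AddMonoidHom.id (Iter A (n + 1)) := by
  refine AddMonoidHom.ext fun x => ?_
  obtain ⟨x, y⟩ := x
  exact Prod.ext (add_zero x) (zero_add y)

theorem triangle_right (n : ℕ) :
    (phi (n + 1)).comp (F (gam n)) = AddMonoidHom.id (Iter A (n + 1)) := by
  refine AddMonoidHom.ext fun x => ?_
  obtain ⟨x, y⟩ := x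
  exact Prod.ext (add_zero x) (zero_add y)

theorem add_self (hA : ∀ a : A, a + a = a) : (n : ℕ) → (x : Iter A n) → x + x = x
  | 0, x => hA x
  | n + 1, x => Prod.ext (add_self hA n x.1) (add_self hA n x.2)

/-- The interpretation of arrow-terms. -/
def interp (A : Type) [AddCommMonoid A] : {m n : ℕ} → ArrowTerm m n → (Iter A m →+ Iter A n)
  | _, _, .one n => AddMonoidHom.id (Iter A n)
  | _, _, .phi n => phi n
  | _, _, .gam n => gam n
  | _, _, .F f => F (interp A f)
  | _, _, .comp g f => (interp A g).comp (interp A f)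

/-- In the model `φ ∘ γ` is `x ↦ x + x`. It is compatible with `F` over any `A`, and is the identity
when addition is idempotent. -/
theorem interp_sound {κ : Kind} (hA : κ = Kind.J → ∀ a : A, a + a = a) {m n : ℕ}
    {f g : ArrowTerm m n} (h : TermEq κ f g) : interp A f = interp A g := by
  induction h with
  | refl f => rfl
  | symm _ ih => exact ih.symm
  | trans _ _ ih₁ ih₂ => exact ih₁.trans ih₂
  | congr_F _ ih => exact congrArg F ih
  | congr_comp _ _ ihf ihg => simp only [interp]; rw [ihf, ihg]
  | comp_one f => rfl
  | one_comp f => rfl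
  | assoc h g f => rfl
  | F_one n => rfl
  | F_comp g f => rfl
  | nat_phi f => exact AddMonoidHom.ext fun x => (interp A f).map_add _ _
  | nat_gam f =>
    refine AddMonoidHom.ext fun x => Prod.ext (Prod.ext rfl ?_) (Prod.ext ?_ rfl)
    · exact (interp A f).map_zero
    · exact (interp A f).map_zero
  | triangle_left n => exact triangle_left n
  | triangle_right n => exact triangle_right n
  | phi_gam_K hκ n => rfl
  | phi_gam_J hκ n => exact AddMonoidHom.ext fun x => add_self (hA hκ) n x

/-- The interpretation of arrows. -/
def arrInterp (A : Type) [AddCommMonoid A] {κ : Kind} (hA : κ = Kind.J → ∀ a : A, a + a = a)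
    {m n : ℕ} : Arr κ m n → (Iter A m →+ Iter A n) :=
  Quotient.lift (interp A) (fun _ _ h => interp_sound hA h)

/-- The diapsides of the model. -/
def diap : (n : ℕ) → ℕ → (Iter A n →+ Iter A n)
  | 0, _ => AddMonoidHom.id _
  | 1, _ => AddMonoidHom.id _
  | n + 2, i => if i = n then (gam n).comp (phi n) else F (diap (n + 1) i)

/-- The interpretation of a word in diapsides. -/
def word (A : Type) [AddCommMonoid A] (n : ℕ) (w : List ℕ) : Iter A n →+ Iter A n :=
  ev (M := AddMonoid.End (Iter A n)) (diap n) w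

theorem word_cons (n i : ℕ) (w : List ℕ) :
    word A n (i :: w) = (diap n i).comp (word A n w) :=
  ev_cons (M := AddMonoid.End (Iter A n)) (diap n) i w

theorem word_append (n : ℕ) (w w' : List ℕ) :
    word A n (w ++ w') = (word A n w).comp (word A n w') :=
  ev_append (M := AddMonoid.End (Iter A n)) (diap n) w w'

/-- The elementary cups of the model. -/
def cup : (n : ℕ) → ℕ → (Iter A (n + 2) →+ Iter A n)
  | 0, _ => phi 0
  | n + 1, i => if i = n + 1 then phi (n + 1) else F (cup n i)

theorem cup_self (n : ℕ) : cup n n = (phi n : Iter A (n + 2) →+ Iter A n) := by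
  cases n <;> simp [cup]

theorem word_succ {n : ℕ} {w : List ℕ} (hw : ∀ i ∈ w, i < n) :
    word A (n + 2) w = F (word A (n + 1) w) := by
  induction w with
  | nil => rfl
  | cons i w ih =>
    rw [word_cons, word_cons, ih fun j hj => hw j (by simp [hj]), diap,
      if_neg (hw i (by simp)).ne, F_comp]

/-- Triangles straighten all the inner turns of a block: what remains is one unit on the two
outermost outputs and one counit on the inputs `a` and `a + 1`, counted from the innermost strand.
-/
theorem word_blk {n a : ℕ} (ha : a ≤ n) :
    word A (n + 2) (blk (n + 1) a) = (gam n).comp (cup n a) := by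
  induction n, ha using Nat.le_induction with
  | base =>
    rw [blk_succ_self, word_cons, cup_self, diap, if_pos rfl]
    rfl
  | succ n ha ih =>
    rw [blk_succ (show a ≤ n + 1 by omega), word_cons,
      word_succ fun i hi => (mem_blk.1 hi).2, ih, diap, if_pos rfl, cup,
      if_neg (show a ≠ n + 1 by omega), F_comp, AddMonoidHom.comp_assoc,
      ← AddMonoidHom.comp_assoc _ _ (phi (n + 1)), triangle_right, AddMonoidHom.id_comp]

/-- The basis vector with a given labelling of the strands, the outermost strand first. -/
def basis (e : A) : (n : ℕ) → List Bool → Iter A n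
  | 0, _ => e
  | _ + 1, [] => 0
  | n + 1, false :: x => (basis e n x, 0)
  | n + 1, true :: x => (0, basis e n x)

/-- The coordinate with a given labelling of the strands, the outermost strand first. -/
def coord : (n : ℕ) → Iter A n → List Bool → A
  | 0, v, _ => v
  | _ + 1, _, [] => 0
  | n + 1, v, false :: y => coord n v.1 y
  | n + 1, v, true :: y => coord n v.2 y

theorem coord_zero (n : ℕ) (y : List Bool) : coord n (0 : Iter A n) y = 0 := by
  induction n generalizing y with
  | zero => rfl
  | succ n ih =>
    match y with
    | [] => rfl
    | false :: y => exact ih y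
    | true :: y => exact ih y

theorem coord_add (n : ℕ) (v w : Iter A n) (y : List Bool) :
    coord n (v + w) y = coord n v y + coord n w y := by
  induction n generalizing y with
  | zero => rfl
  | succ n ih =>
    match y with
    | [] => exact (add_zero _).symm
    | false :: y => exact ih _ _ y
    | true :: y => exact ih _ _ y

theorem coord_nsmul (n k : ℕ) (v : Iter A n) (y : List Bool) :
    coord n (k • v) y = k • coord n v y := by
  induction k with
  | zero => rw [zero_nsmul, zero_nsmul, coord_zero]
  | succ k ih => rw [succ_nsmul, succ_nsmul, coord_add, ih]

theorem coord_F {m n : ℕ} (e : A) (f : Iter A m →+ Iter A n) (b b' : Bool) (x y : List Bool) :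
    coord (n + 1) (F f (basis e (m + 1) (b :: x))) (b' :: y) =
      if b = b' then coord n (f (basis e m x)) y else 0 := by
  cases b <;> cases b' <;> simp only [basis, F_apply, coord, map_zero, coord_zero] <;> rfl

theorem cup_basis (e : A) {n a : ℕ} (s r : List Bool) (b b' : Bool)
    (hs : s.length + a = n) :
    cup n a (basis e (n + 2) (s ++ b :: b' :: r)) =
      if b = b' then basis e n (s ++ r) else 0 := by
  induction s generalizing n with
  | nil =>
    obtain rfl : a = n := by simpa using hs
    rw [cup_self]
    cases b <;> cases b' <;> simp only [List.nil_append, basis] <;>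
      rw [← Prod.mk.eta (p := (0 : Iter A (a + 1)))]
    · exact add_zero _
    · exact add_zero (0 : Iter A a)
    · exact add_zero (0 : Iter A a)
    · exact zero_add _
  | cons t s ih =>
    obtain ⟨n, rfl⟩ : ∃ k, n = k + 1 := ⟨s.length + a, by simp at hs; omega⟩
    have hs' : s.length + a = n := by simp at hs; omega
    rw [cup, if_neg (show a ≠ n + 1 by omega)]
    have h := ih hs'
    by_cases hb : b = b'
    · rw [if_pos hb] at h ⊢
      cases t <;> simp only [List.cons_append, basis, F_apply, map_zero, h] <;> rfl
    · rw [if_neg hb] at h ⊢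
      cases t <;> simp only [List.cons_append, basis, F_apply, map_zero, h] <;> rfl

/-- The support of the interpretation of a word. -/
def Rel (e : A) (n : ℕ) (w : List ℕ) (x y : List Bool) : Prop :=
  coord n (word A n w (basis e n x)) y ≠ 0

/-! ### Recovering a normal form from its support -/

theorem rel_nil {e : A} (he : e ≠ 0) {n : ℕ} {x : List Bool} (hx : x.length = n) :
    Rel e n [] x x := by
  change coord n (basis e n x) x ≠ 0
  induction n generalizing x with
  | zero => exact he
  | succ n ih =>
    match x with
    | [] => simp at hx
    | false :: x => exact ih (by simpa using hx)
    | true :: x => exact ih (by simpa using hx)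

theorem rel_skip {e : A} {n : ℕ} {u : List ℕ} (hu : ∀ i ∈ u, i < n) {b b' : Bool}
    {x y : List Bool} :
    Rel e (n + 2) u (b :: x) (b' :: y) ↔ b = b' ∧ Rel e (n + 1) u x y := by
  unfold Rel
  rw [word_succ hu, coord_F]
  split <;> simp_all

/-- The counit forces `b = b'` and deletes both. The unit then creates two outer strands with a
common label: one goes straight to the output, the other is the outermost input of `u`, so both
carry `c`. -/
theorem rel_block {e : A} {n a : ℕ} {u : List ℕ} (hu : ∀ i ∈ u, i < n)
    {s r y : List Bool} {b b' c : Bool} (hs : s.length + a = n) :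
    Rel e (n + 2) (u ++ blk (n + 1) a) (s ++ b :: b' :: r) (c :: y) ↔
      b = b' ∧ Rel e (n + 1) u (c :: (s ++ r)) y := by
  unfold Rel
  rw [word_append, word_succ hu, word_blk (by omega), AddMonoidHom.comp_apply,
    AddMonoidHom.comp_apply]
  rw [cup_basis e s r b b' hs]
  split
  case isTrue h =>
    simp only [h, true_and]
    cases c <;> rfl
  case isFalse h => simp [h, coord_zero]

/-- A constant labelling is compatible with every diagram. -/
theorem rel_false {e : A} (he : e ≠ 0) {m p : ℕ} {w : List ℕ} (hw : NF m p w) :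
    Rel e (m + 1) w (List.replicate (m + 1) false) (List.replicate (m + 1) false) := by
  induction hw with
  | nil p => exact rel_nil he (by simp)
  | skip hu ih =>
    rw [List.replicate_succ]
    exact (rel_skip hu.lt_of_mem).2 ⟨rfl, ih⟩
  | @block m p a u hu h₁ h₂ ih =>
    have hx : List.replicate (m + 1 + 1) false =
        List.replicate (m - a) false ++ false :: false :: List.replicate a false := by
      rw [← List.replicate_succ, ← List.replicate_succ, List.replicate_append_replicate]
      congr 1; omega
    have hz : List.replicate (m + 1) false =
        false :: (List.replicate (m - a) false ++ List.replicate a false) := by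
      rw [List.replicate_append_replicate, ← List.replicate_succ]
      congr 1; omega
    conv => arg 4; rw [hx]
    conv => arg 5; rw [List.replicate_succ]
    refine (rel_block hu.lt_of_mem (by simp; omega)).2 ⟨rfl, ?_⟩
    rwa [← hz]

/-- If all blocks end below `p`, no counit joins the adjacent inputs `k` and `k + 1` for `k ≥ p`, so
their labels may differ. -/
theorem exists_rel_ne {e : A} (he : e ≠ 0) {m p k : ℕ} {w : List ℕ} (hw : NF m p w) (hp : p ≤ k)
    (hk : k < m) :
    ∃ (s r y : List Bool) (b : Bool), s.length + k + 1 = m ∧ r.length = k ∧ y.length = m + 1 ∧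
      Rel e (m + 1) w (s ++ b :: (!b) :: r) y := by
  induction hw generalizing k with
  | nil p => omega
  | @skip m p u hu ih =>
    rcases Nat.lt_succ_iff_lt_or_eq.1 hk with hk | rfl
    · obtain ⟨s, r, y, b, h₁, h₂, h₃, h₄⟩ := ih hp hk
      exact ⟨false :: s, r, false :: y, b, by simp; omega, h₂, by simp; omega,
        (rel_skip hu.lt_of_mem).2 ⟨rfl, h₄⟩⟩
    · exact ⟨[], List.replicate k false, true :: List.replicate (k + 1) false, true, by simp,
        by simp, by simp, (rel_skip hu.lt_of_mem).2 ⟨rfl, rel_false he hu⟩⟩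
  | @block m p a u hu h₁ h₂ ih =>
    rcases Nat.lt_or_ge k (a + 2) with hka | hka
    -- The pair shares the strand `a + 1` with the counit; labelling the two ends of that counit
    -- `true` and all other strands `false` separates it.
    · obtain rfl : k = a + 1 := by omega
      refine ⟨List.replicate (m - 1 - a) false, true :: List.replicate a false,
        false :: List.replicate (m + 1) false, false, by simp; omega, by simp, by simp, ?_⟩
      have hx : List.replicate (m - 1 - a) false ++ false :: (!false) :: true ::
          List.replicate a false = (List.replicate (m - 1 - a) false ++ [false]) ++
          true :: true :: List.replicate a false := by simp
      rw [hx]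
      refine (rel_block hu.lt_of_mem (by simp; omega)).2 ⟨rfl, ?_⟩
      have hz : false :: (List.replicate (m - 1 - a) false ++ [false] ++ List.replicate a false) =
          List.replicate (m + 1) false := by
        rw [← List.replicate_one, List.replicate_append_replicate,
          List.replicate_append_replicate, ← List.replicate_succ]
        congr 1; omega
      rw [hz]
      exact rel_false he hu
    -- The pair lies outside the counit, and deleting the counit moves it to `k - 2`.
    · obtain ⟨s, r, y, b, h₃, h₄, h₅, h₆⟩ := ih (k := k - 2) (by omega) (by omega)
      match s with
      | [] => simp at h₃; omega
      | c :: s =>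
        refine ⟨s, r.take (k - 2 - a) ++ false :: false :: r.drop (k - 2 - a), c :: y, b,
          by simp at h₃; omega, by simp; omega, by simp; omega, ?_⟩
        have hx : s ++ b :: (!b) :: (r.take (k - 2 - a) ++ false :: false :: r.drop (k - 2 - a)) =
            (s ++ b :: (!b) :: r.take (k - 2 - a)) ++ false :: false :: r.drop (k - 2 - a) := by
          simp
        rw [hx]
        refine (rel_block hu.lt_of_mem (by simp at h₃ ⊢; omega)).2 ⟨rfl, ?_⟩
        simpa using h₆

/-- This tells a block from `skip`, under which the outermost strand is straight and its two labels
agree. -/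
theorem exists_rel_block_head_ne {e : A} (he : e ≠ 0) {m a : ℕ} {u : List ℕ} (hu : NF m a u)
    (ha : a ≤ m) :
    ∃ (x y : List Bool) (b : Bool), x.length = m + 1 ∧ y.length = m + 1 ∧
      Rel e (m + 2) (u ++ blk (m + 1) a) (b :: x) ((!b) :: y) := by
  rcases ha.lt_or_eq with ha | rfl
  · obtain ⟨s, r, y, b, h₃, h₄, h₅, h₆⟩ := exists_rel_ne he hu (k := m - 1) (by omega) (by omega)
    obtain rfl : s = [] := List.length_eq_zero_iff.1 (by omega)
    refine ⟨r.take (m - 1 - a) ++ false :: false :: r.drop (m - 1 - a), y, !b, by simp; omega, h₅,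
      ?_⟩
    rw [← List.cons_append]
    refine (rel_block hu.lt_of_mem (by simp; omega)).2 ⟨rfl, ?_⟩
    simpa using h₆
  · refine ⟨true :: List.replicate a false, List.replicate (a + 1) false, true, by simp, by simp,
      ?_⟩
    exact (rel_block (s := []) hu.lt_of_mem (by simp)).2 ⟨rfl, rel_false he hu⟩

/-- The second word forces equal labels at inputs `a'` and `a' + 1`; the first, whose blocks all end
at most at `a < a'`, does not. -/
theorem not_lt_of_rel {e : A} (he : e ≠ 0) {m a a' : ℕ} {u u' : List ℕ} (hu : NF m a u)
    (hu' : NF m a' u') (ha : a ≤ m) (ha' : a' ≤ m)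
    (h : ∀ x y : List Bool, x.length = m + 2 → y.length = m + 2 →
      Rel e (m + 2) (u ++ blk (m + 1) a) x y → Rel e (m + 2) (u' ++ blk (m + 1) a') x y) :
    ¬ a < a' := by
  intro haa
  obtain ⟨s, r, y, b, h₁, h₂, h₃, h₄⟩ := exists_rel_ne he
    (NF.block hu ha (Nat.lt_succ_self a)) (k := a') (by omega) (by omega)
  match y with
  | [] => simp at h₃
  | c :: y =>
    have := h _ _ (by simp; omega) h₃ h₄
    rw [rel_block hu'.lt_of_mem (by omega)] at this
    cases b <;> simp at this

/-- The outermost strand decides between `skip` and a block, the outermost counit joining adjacent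
inputs gives the end of the block, and deleting that counit leaves the support of the shorter word.
-/
theorem nf_eq_of_rel {e : A} (he : e ≠ 0) {m p p' : ℕ} {w w' : List ℕ} (hw : NF m p w)
    (hw' : NF m p' w')
    (h : ∀ x y : List Bool, x.length = m + 1 → y.length = m + 1 →
      (Rel e (m + 1) w x y ↔ Rel e (m + 1) w' x y)) : w = w' := by
  induction hw generalizing p' w' with
  | nil p => cases hw'; rfl
  | @skip m p u hu ih =>
    cases hw' with
    | skip hu' =>
      refine ih hu' fun x y hx hy => ?_
      have := h (false :: x) (false :: y) (by simp [hx]) (by simp [hy])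
      rwa [rel_skip hu.lt_of_mem, rel_skip hu'.lt_of_mem, and_iff_right rfl,
        and_iff_right rfl] at this
    | block hu' ha' _ =>
      obtain ⟨x, y, b, hx, hy, hR⟩ := exists_rel_block_head_ne he hu' ha'
      have := (h _ _ (by simp [hx]) (by simp [hy])).2 hR
      rw [rel_skip hu.lt_of_mem] at this
      cases b <;> simp at this
  | @block m p a u hu ha _ ih =>
    cases hw' with
    | skip hu' =>
      obtain ⟨x, y, b, hx, hy, hR⟩ := exists_rel_block_head_ne he hu ha
      have := (h _ _ (by simp [hx]) (by simp [hy])).1 hR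
      rw [rel_skip hu'.lt_of_mem] at this
      cases b <;> simp at this
    | @block _ _ a' u' hu' ha' _ =>
      obtain rfl : a = a' := by
        have h₁ := not_lt_of_rel he hu hu' ha ha' fun x y hx hy => (h x y hx hy).1
        have h₂ := not_lt_of_rel he hu' hu ha' ha fun x y hx hy => (h x y hx hy).2
        omega
      rw [ih hu' fun x y hx hy => ?_]
      match x with
      | [] => simp at hx
      | c :: z =>
        have hz : z.length = m := by simpa using hx
        have := h (z.take (m - a) ++ false :: false :: z.drop (m - a)) (c :: y)
          (by simp; omega) (by simp [hy])
        rw [rel_block hu.lt_of_mem (by simp; omega),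
          rel_block hu'.lt_of_mem (by simp; omega), and_iff_right rfl, and_iff_right rfl,
          List.take_append_drop] at this
        exact this

end Iter


/-! ### Endomorphisms and diapsides -/

namespace Arr

variable {κ : Kind}

/-- The circle `φ_n ∘ γ_n`. -/
def circ (κ : Kind) (n : ℕ) : Arr κ n n := comp (phi n) (gam n)

/-- The diapsis `γ_n ∘ φ_n`. -/
def turn (κ : Kind) (n : ℕ) : Arr κ (n + 2) (n + 2) := comp (gam n) (phi n)

/-- All later uses of `κ ≠ Kind.L` go back to this: circles at different depths become one central
generator. -/
theorem F_circ (hκ : κ ≠ Kind.L) (n : ℕ) : F (circ κ n) = circ κ (n + 1) := by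
  match κ with
  | .L => exact absurd rfl hκ
  | .K => exact Quotient.sound (TermEq.phi_gam_K rfl n)
  | .J =>
    have h : ∀ n, circ Kind.J n = one n := fun n => Quotient.sound (TermEq.phi_gam_J rfl n)
    rw [h, h, F_one]

theorem comp_circ {m n : ℕ} (f : Arr κ m n) : comp f (circ κ m) = comp (circ κ n) f := by
  rw [circ, circ, assoc, nat_phi, ← assoc, nat_gam, assoc]

/-- Together with `F_gam`, this trades shifted counits and units for unshifted ones and diapsides.
-/
theorem F_phi (n : ℕ) : F (phi n) = comp (phi (n + 1)) (F (turn κ n)) := by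
  rw [turn, F_comp, assoc, triangle_right, one_comp]

theorem F_gam (n : ℕ) : F (gam n) = comp (F (turn κ n)) (gam (n + 1)) := by
  rw [turn, F_comp, ← assoc, triangle_left, comp_one]

theorem turn_comp_turn (n : ℕ) : comp (turn κ n) (turn κ n) = comp (circ κ (n + 2)) (turn κ n) := by
  have h : comp (turn κ n) (turn κ n) = comp (gam n) (comp (circ κ n) (phi n)) := by
    simp only [turn, circ, assoc]
  rw [h, assoc, comp_circ, ← assoc]
  rfl

theorem turn_comm {n : ℕ} (f : Arr κ n n) :
    comp (F (F f)) (turn κ n) = comp (turn κ n) (F (F f)) := by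
  rw [turn, assoc, nat_gam, ← assoc, nat_phi, assoc]

theorem turn_braid_up (n : ℕ) :
    comp (comp (F (turn κ n)) (turn κ (n + 1))) (F (turn κ n)) = F (turn κ n) := by
  have h : comp (F (turn κ n)) (turn κ (n + 1)) = comp (F (gam n)) (phi (n + 1)) := by
    rw [F_gam, turn, turn, assoc]
  rw [h, ← assoc, ← F_phi, turn, F_comp]

theorem turn_braid_down (n : ℕ) :
    comp (comp (turn κ (n + 1)) (F (turn κ n))) (turn κ (n + 1)) = turn κ (n + 1) := by
  have h : comp (turn κ (n + 1)) (F (turn κ n)) = comp (gam (n + 1)) (F (phi n)) := by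
    rw [F_phi, turn, assoc]
  rw [h]
  have h' : comp (F (phi n)) (turn κ (n + 1)) = phi (n + 1) := by
    rw [turn, assoc, triangle_left, one_comp]
  rw [← assoc, h', turn]

/-- The endomorphisms generated by diapsides and circles. -/
inductive Diap (κ : Kind) : (n : ℕ) → Arr κ n n → Prop
  | one (n : ℕ) : Diap κ n (one n)
  | circ (n : ℕ) : Diap κ n (circ κ n)
  | turn (n : ℕ) : Diap κ (n + 2) (turn κ n)
  | F {n : ℕ} {f : Arr κ n n} : Diap κ n f → Diap κ (n + 1) (F f)
  | comp {n : ℕ} {g f : Arr κ n n} : Diap κ n g → Diap κ n f → Diap κ n (comp g f)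

/-- `d` comes from one strand less, or uses the outermost diapsis just once. -/
def IsReduced (κ : Kind) : (n : ℕ) → Arr κ n n → Prop
  | 0, _ => True
  | 1, d => ∃ a, Diap κ 0 a ∧ d = F a
  | n + 2, d => (∃ a, Diap κ (n + 1) a ∧ d = F a) ∨
      ∃ a b, Diap κ (n + 1) a ∧ Diap κ (n + 1) b ∧
        d = comp (comp (F a) (gam n)) (comp (phi n) (F b))

/-! ### Reduction to at most one outermost diapsis -/

theorem isReduced_F {n : ℕ} {a : Arr κ n n} (ha : Diap κ n a) : IsReduced κ (n + 1) (F a) := by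
  cases n with
  | zero => exact ⟨a, ha, rfl⟩
  | succ n => exact Or.inl ⟨a, ha, rfl⟩

/-- If `a = F b`, closing off creates a circle next to `b`. If `a` contains an outermost diapsis,
the two triangles absorb it and leave the product of the two outer factors. -/
theorem diap_phi_F_gam {n : ℕ} {a : Arr κ (n + 1) (n + 1)} (h : IsReduced κ (n + 1) a) :
    Diap κ n (comp (phi n) (comp (F a) (gam n))) := by
  have key : ∀ b, Diap κ n b → Diap κ n (comp (phi n) (comp (F (F b)) (gam n))) := by
    intro b hb
    rw [nat_gam, assoc]
    exact (Diap.circ n).comp hb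
  cases n with
  | zero =>
    obtain ⟨b, hb, rfl⟩ := h
    exact key b hb
  | succ n =>
    rcases h with ⟨b, hb, rfl⟩ | ⟨x, y, hx, hy, rfl⟩
    · exact key b hb
    · have : comp (phi (n + 1)) (comp (F (comp (comp (F x) (gam n)) (comp (phi n) (F y))))
          (gam (n + 1))) = comp x y := by
        have h₁ : comp (phi (n + 1)) (F (comp (F x) (gam n))) = x := by
          rw [F_comp, assoc, ← nat_phi, ← assoc, triangle_right, comp_one]
        have h₂ : comp (F (comp (phi n) (F y))) (gam (n + 1)) = y := by
          rw [F_comp, ← assoc, nat_gam, assoc, triangle_left, one_comp]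
        rw [F_comp, ← assoc, h₂, assoc, h₁]
      rw [this]
      exact hx.comp hy

theorem isReduced_comp {n : ℕ} (ih : ∀ a, Diap κ n a → IsReduced κ n a)
    {d d' : Arr κ (n + 1) (n + 1)}
    (h : IsReduced κ (n + 1) d) (h' : IsReduced κ (n + 1) d') :
    IsReduced κ (n + 1) (comp d d') := by
  cases n with
  | zero =>
    obtain ⟨a, ha, rfl⟩ := h
    obtain ⟨b, hb, rfl⟩ := h'
    exact ⟨_, ha.comp hb, (F_comp a b).symm⟩
  | succ n =>
    rcases h with ⟨a, ha, rfl⟩ | ⟨a, b, ha, hb, rfl⟩ <;>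
      rcases h' with ⟨a', ha', rfl⟩ | ⟨a', b', ha', hb', rfl⟩
    · exact Or.inl ⟨_, ha.comp ha', (F_comp _ _).symm⟩
    · exact Or.inr ⟨_, b', ha.comp ha', hb', by rw [F_comp]; simp only [assoc]⟩
    · exact Or.inr ⟨a, _, ha, hb.comp ha', by rw [F_comp, ← assoc, ← assoc, ← assoc, ← assoc]⟩
    -- What lies between the two outermost diapsides closes up to an endomorphism of `n`, which
    -- slides out through `γ` by naturality, so one diapsis suffices.
    · have hy := diap_phi_F_gam (ih _ (hb.comp ha'))
      refine Or.inr ⟨_, b', ha.comp hy.F, hb', ?_⟩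
      rw [F_comp a, ← assoc (F a) (F (F _)), nat_gam, F_comp]
      simp only [assoc]

theorem Diap.isReduced (hκ : κ ≠ Kind.L) {n : ℕ} {d : Arr κ n n} (h : Diap κ n d) :
    IsReduced κ n d := by
  induction n with
  | zero => trivial
  | succ n ih =>
    have key : ∀ m (d : Arr κ m m), Diap κ m d → m = n + 1 → IsReduced κ m d := by
      intro m d hd
      induction hd with
      | one m =>
        rintro rfl
        rw [← F_one]
        exact isReduced_F (Diap.one n)
      | circ m =>
        rintro rfl
        rw [← F_circ hκ]
        exact isReduced_F (Diap.circ n)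
      | turn m =>
        intro
        refine Or.inr ⟨_, _, Diap.one _, Diap.one _, ?_⟩
        rw [F_one, one_comp, comp_one]; rfl
      | F hf _ => exact fun _ => isReduced_F hf
      | comp _ _ ih₁ ih₂ =>
        rintro rfl
        exact isReduced_comp (fun a => ih) (ih₁ rfl) (ih₂ rfl)
    exact key _ d h rfl

theorem Diap.phi_gam (hκ : κ ≠ Kind.L) {n : ℕ} {d : Arr κ (n + 2) (n + 2)} (h : Diap κ (n + 2) d) :
    Diap κ n (Arr.comp (phi n) (Arr.comp d (gam n))) := by
  rcases h.isReduced hκ with ⟨a, ha, rfl⟩ | ⟨a, b, ha, hb, rfl⟩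
  · exact diap_phi_F_gam (ha.isReduced hκ)
  · have := (diap_phi_F_gam (ha.isReduced hκ)).comp (diap_phi_F_gam (hb.isReduced hκ))
    simpa only [assoc] using this

/-- The arrows composed of endomorphisms generated by diapsides and circles, and of units. -/
inductive Up (κ : Kind) {m : ℕ} : (n : ℕ) → Arr κ m n → Prop
  | base {d : Arr κ m m} : Diap κ m d → Up κ m d
  | step {n : ℕ} {d : Arr κ (n + 2) (n + 2)} {f : Arr κ m n} :
      Diap κ (n + 2) d → Up κ n f → Up κ (n + 2) (comp d (comp (gam n) f))

/-- The arrows composed of endomorphisms generated by diapsides and circles, and of counits. -/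
inductive Down (κ : Kind) {n : ℕ} : (m : ℕ) → Arr κ m n → Prop
  | base {d : Arr κ n n} : Diap κ n d → Down κ n d
  | step {m : ℕ} {d : Arr κ (m + 2) (m + 2)} {f : Arr κ m n} :
      Diap κ (m + 2) d → Down κ m f → Down κ (m + 2) (comp (comp f (phi m)) d)

/-- The arrows composed of endomorphisms generated by diapsides and circles, of units, and
of counits. -/
inductive Gen (κ : Kind) {m : ℕ} : (n : ℕ) → Arr κ m n → Prop
  | base {d : Arr κ m m} : Diap κ m d → Gen κ m d
  | cap {n : ℕ} {d : Arr κ (n + 2) (n + 2)} {f : Arr κ m n} :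
      Diap κ (n + 2) d → Gen κ n f → Gen κ (n + 2) (comp d (comp (gam n) f))
  | cup {n : ℕ} {d : Arr κ (n + 2) (n + 2)} {f : Arr κ m (n + 2)} :
      Diap κ (n + 2) d → Gen κ (n + 2) f → Gen κ n (comp (phi n) (comp d f))

/-! ### Factorization of arrows through units only or counits only -/

theorem Gen.diap_comp {m n : ℕ} {f : Arr κ m n} (h : Gen κ n f) {d : Arr κ n n} (hd : Diap κ n d) :
    Gen κ n (Arr.comp d f) := by
  cases h with
  | base h => exact Gen.base (hd.comp h)
  | cap h hf => rw [assoc]; exact Gen.cap (hd.comp h) hf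
  | cup h hf =>
    rw [assoc, nat_phi, ← assoc, assoc (Arr.F _)]
    exact Gen.cup (hd.F.F.comp h) hf

theorem Gen.comp {m n k : ℕ} {g : Arr κ n k} {f : Arr κ m n} (hg : Gen κ k g) (hf : Gen κ n f) :
    Gen κ k (Arr.comp g f) := by
  induction hg with
  | base h => exact hf.diap_comp h
  | cap h _ ih => rw [← assoc, ← assoc]; exact Gen.cap h ih
  | cup h _ ih => rw [← assoc, ← assoc]; exact Gen.cup h ih

theorem Gen.F {m n : ℕ} {f : Arr κ m n} (h : Gen κ n f) : Gen κ (n + 1) (Arr.F f) := by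
  induction h with
  | base h => exact Gen.base h.F
  | @cap n d f h _ ih =>
    rw [F_comp, F_comp, F_gam, ← assoc (Arr.F (Arr.turn κ n)), assoc (Arr.F d)]
    exact Gen.cap (h.F.comp (Diap.turn n).F) ih
  | @cup n d f h _ ih =>
    rw [F_comp, F_comp, F_phi, ← assoc, assoc (Arr.F (Arr.turn κ n))]
    exact Gen.cup ((Diap.turn n).F.comp h.F) ih

theorem gen {m n : ℕ} (f : Arr κ m n) : Gen κ n f := by
  induction f using Quotient.inductionOn with
  | _ f =>
    induction f with
    | one n => exact Gen.base (Diap.one n)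
    | phi n =>
      have := Gen.cup (Diap.one (n + 2)) (Gen.base (Diap.one (κ := κ) (n + 2)))
      rwa [comp_one, comp_one] at this
    | gam n =>
      have := Gen.cap (Diap.one (n + 2)) (Gen.base (Diap.one (κ := κ) n))
      rwa [comp_one, one_comp] at this
    | F f ih => exact ih.F
    | comp g f ihg ihf => exact ihg.comp ihf

theorem Up.diap_comp {m n : ℕ} {f : Arr κ m n} (h : Up κ n f) {d : Arr κ n n} (hd : Diap κ n d) :
    Up κ n (comp d f) := by
  cases h with
  | base h => exact Up.base (hd.comp h)
  | step h hf => rw [assoc]; exact Up.step (hd.comp h) hf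

theorem Down.diap_comp {m n : ℕ} {f : Arr κ m n} (h : Down κ m f) {d : Arr κ n n}
    (hd : Diap κ n d) : Down κ m (comp d f) := by
  induction h with
  | base h => exact Down.base (hd.comp h)
  | step h hf ih => rw [assoc, assoc]; exact Down.step h ih

theorem Down.comp_diap {m n : ℕ} {f : Arr κ m n} (h : Down κ m f) {d : Arr κ m m}
    (hd : Diap κ m d) : Down κ m (comp f d) := by
  cases h with
  | base h => exact Down.base (h.comp hd)
  | step h hf => rw [← assoc]; exact Down.step (h.comp hd) hf

/-- Naturality slides `f` past `φ`, after which `γ` and `φ` meet in a diapsis. -/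
theorem Down.gam_phi {m n : ℕ} {f : Arr κ m n} (h : Down κ m f) :
    Down κ (m + 2) (comp (gam n) (comp f (phi m))) := by
  induction h with
  | @base d h =>
    rw [nat_phi, assoc]
    exact Down.base ((Diap.turn n).comp h.F.F)
  | @step m d f h hf ih =>
    have := Down.step h.F.F ih
    rw [← assoc _ d, nat_phi d]
    simpa only [assoc] using this

theorem Down.gam_comp {m n : ℕ} {f : Arr κ m n} (h : Down κ m f) :
    Up κ (n + 2) (comp (gam n) f) ∨ Down κ m (comp (gam n) f) := by
  cases h with
  | base h =>
    have := Up.step (Diap.one _) (Up.base h)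
    rw [one_comp] at this
    exact Or.inl this
  | step h hf =>
    rw [assoc]
    exact Or.inr (hf.gam_phi.comp_diap h)

theorem Down.phi_comp {m n : ℕ} {f : Arr κ m (n + 2)} (h : Down κ m f) :
    Down κ m (comp (phi n) f) := by
  induction h with
  | base h =>
    have := Down.step h (Down.base (Diap.one n))
    rwa [one_comp] at this
  | step h hf ih => rw [assoc, assoc]; exact Down.step h ih

/-- A counit meeting the last unit encloses an endomorphism; by `Diap.phi_gam` the result is again
generated by diapsides and circles, so the pair disappears. -/
theorem Up.phi_comp (hκ : κ ≠ Kind.L) {m n : ℕ} {f : Arr κ m (n + 2)} (h : Up κ (n + 2) f) :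
    Up κ n (comp (phi n) f) ∨ Down κ m (comp (phi n) f) := by
  cases h with
  | base h => exact Or.inr (Down.base h).phi_comp
  | step h hf =>
    have := hf.diap_comp (h.phi_gam hκ)
    rw [← assoc, ← assoc] at this
    exact Or.inl this

theorem up_or_down (hκ : κ ≠ Kind.L) {m n : ℕ} (f : Arr κ m n) : Up κ n f ∨ Down κ m f := by
  induction gen f with
  | base h => exact Or.inl (Up.base h)
  | cap h _ ih =>
    rcases ih with ih | ih
    · exact Or.inl (Up.step h ih)
    · exact ih.gam_comp.imp (fun h' => h'.diap_comp h) (fun h' => h'.diap_comp h)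
  | cup h _ ih =>
    rcases ih with ih | ih
    · exact (ih.diap_comp h).phi_comp hκ
    · exact Or.inr (ih.diap_comp h).phi_comp

theorem Up.le {m n : ℕ} {f : Arr κ m n} (h : Up κ n f) : m ≤ n := by
  induction h with
  | base _ => exact le_rfl
  | step _ _ ih => omega

theorem Down.le {m n : ℕ} {f : Arr κ m n} (h : Down κ m f) : n ≤ m := by
  induction h with
  | base _ => exact le_rfl
  | step _ _ ih => omega

/-- Each unit raises the target by two and each counit raises the source by two, so an endomorphism
in either one-sided form contains none. -/
theorem diap (hκ : κ ≠ Kind.L) {n : ℕ} (f : Arr κ n n) : Diap κ n f := by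
  rcases up_or_down hκ f with h | h
  · have key : ∀ k (f : Arr κ n k), Up κ k f → ∀ e : k = n, Diap κ n (e ▸ f) := by
      intro k f h
      cases h with
      | base h => exact fun _ => h
      | step _ h =>
        intro e
        have := h.le
        omega
    exact key n f h rfl
  · have key : ∀ k (f : Arr κ k n), Down κ k f → ∀ e : k = n, Diap κ n (e ▸ f) := by
      intro k f h
      cases h with
      | base h => exact fun _ => h
      | step _ h =>
        intro e
        have := h.le
        omega
    exact key n f h rfl

/-- The diapsides on `n` strands. -/
def diapsis (κ : Kind) : (n : ℕ) → ℕ → Arr κ n n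
  | 0, _ => one 0
  | 1, _ => one 1
  | n + 2, i => if i = n then turn κ n else F (diapsis κ (n + 1) i)

theorem diapsis_self (n : ℕ) : diapsis κ (n + 2) n = turn κ n := by simp [diapsis]

/-! ### Relations among the diapsides on `n` strands -/

theorem diapsis_succ {n i : ℕ} (hi : i + 2 ≤ n) : diapsis κ (n + 1) i = F (diapsis κ n i) := by
  obtain ⟨n, rfl⟩ : ∃ k, n = k + 1 := ⟨n - 1, by omega⟩
  rw [diapsis, if_neg (by omega)]

theorem diapsis_comm {n i j : ℕ} (hij : i + 2 ≤ j) (hj : j + 2 ≤ n) :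
    comp (diapsis κ n i) (diapsis κ n j) = comp (diapsis κ n j) (diapsis κ n i) := by
  induction n, hj using Nat.le_induction with
  | base =>
    rw [diapsis_self, diapsis_succ (show i + 2 ≤ j + 1 by omega), diapsis_succ hij, turn_comm]
  | succ n hn ih =>
    rw [diapsis_succ hn, diapsis_succ (show i + 2 ≤ n by omega), ← F_comp, ih, F_comp]

theorem diapsis_braid_up {n i : ℕ} (hi : i + 3 ≤ n) :
    comp (comp (diapsis κ n i) (diapsis κ n (i + 1))) (diapsis κ n i) = diapsis κ n i := by
  induction n, hi using Nat.le_induction with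
  | base => rw [diapsis_self (i + 1), diapsis_succ le_rfl, diapsis_self, turn_braid_up]
  | succ n hn ih =>
    rw [diapsis_succ (show i + 2 ≤ n by omega), diapsis_succ (show i + 1 + 2 ≤ n by omega),
      ← F_comp, ← F_comp, ih]

theorem diapsis_braid_down {n i : ℕ} (hi : i + 3 ≤ n) :
    comp (comp (diapsis κ n (i + 1)) (diapsis κ n i)) (diapsis κ n (i + 1)) =
      diapsis κ n (i + 1) := by
  induction n, hi using Nat.le_induction with
  | base => rw [diapsis_self (i + 1), diapsis_succ le_rfl, diapsis_self, turn_braid_down]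
  | succ n hn ih =>
    rw [diapsis_succ (show i + 2 ≤ n by omega), diapsis_succ (show i + 1 + 2 ≤ n by omega),
      ← F_comp, ← F_comp, ih]

theorem diapsis_comp_self (hκ : κ ≠ Kind.L) {n i : ℕ} (hi : i + 2 ≤ n) :
    comp (diapsis κ n i) (diapsis κ n i) = comp (circ κ n) (diapsis κ n i) := by
  induction n, hi using Nat.le_induction with
  | base => rw [diapsis_self, turn_comp_turn]
  | succ n hn ih => rw [diapsis_succ hn, ← F_comp, ih, F_comp, F_circ hκ]

theorem mk_diapsis {n i : ℕ} (hi : i + 2 ≤ n) :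
    (⟨diapsis κ n i⟩ : Any (Arr κ)) = diapArr κ n (i + 1) := by
  have key : (⟨diapsis κ n i⟩ : Any (Arr κ)) = anyF^[n - (i + 2)] ⟨turn κ i⟩ := by
    induction n, hi using Nat.le_induction with
    | base => rw [diapsis_self, Nat.sub_self]; rfl
    | succ n hn ih =>
      rw [show n + 1 - (i + 2) = n - (i + 2) + 1 by omega, Function.iterate_succ_apply', ← ih,
        diapsis_succ hn]
      rfl
  rw [key, diapArr, Nat.sub_sub]
  rfl

end Arr


/-! ### The monoids of endomorphisms -/

section Presented

variable {n : ℕ} {rel : FreeMonoid (DGen n) → FreeMonoid (DGen n) → Prop}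

/-- The diapsides of a presented monoid, counted from zero. -/
def pdiap (rel : FreeMonoid (DGen n) → FreeMonoid (DGen n) → Prop) (i : ℕ) :
    PresentedMonoid rel :=
  if hi : i + 1 < n then PresentedMonoid.of rel (DGen.h (i + 1) (Nat.le_add_left 1 i) hi) else 1

theorem pdiap_of_lt {i : ℕ} (hi : i + 1 < n) :
    pdiap rel i = PresentedMonoid.of rel (DGen.h (i + 1) (Nat.le_add_left 1 i) hi) :=
  dif_pos hi

theorem isDiapsidal_pdiap (hrel : ∀ t u, KnRel n t u → rel t u) :
    IsDiapsidal (n - 1) (pdiap rel) (PresentedMonoid.of rel DGen.c) where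
  comm i j hij hj := by
    obtain ⟨j, rfl⟩ := Nat.exists_eq_add_of_le hij
    have := PresentedMonoid.mk_eq_mk_of_rel (hrel _ _ (KnRel.h_comm (i + 1) (i + j + 1) (by omega)
      (by omega) (by omega) (by omega) (by omega)))
    rw [pdiap_of_lt (by omega), pdiap_of_lt (by omega)]
    simp only [show i + 2 + j + 1 = i + j + 1 + 2 by omega]
    exact this
  braid_up i hi := by
    rw [pdiap_of_lt (by omega), pdiap_of_lt (by omega)]
    exact PresentedMonoid.mk_eq_mk_of_rel (hrel _ _ (KnRel.h_braid (i + 1) (i + 1 + 1) (by omega)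
      (by omega) (by omega) (by omega) (Or.inl rfl)))
  braid_down i hi := by
    rw [pdiap_of_lt (by omega), pdiap_of_lt (by omega)]
    exact PresentedMonoid.mk_eq_mk_of_rel (hrel _ _ (KnRel.h_braid (i + 1 + 1) (i + 1) (by omega)
      (by omega) (by omega) (by omega) (Or.inr rfl)))
  h_c i hi := by
    rw [pdiap_of_lt (by omega)]
    exact PresentedMonoid.mk_eq_mk_of_rel (hrel _ _ (KnRel.h_c (i + 1) (by omega) (by omega)))
  h_h i hi := by
    rw [pdiap_of_lt (by omega)]
    exact PresentedMonoid.mk_eq_mk_of_rel (hrel _ _ (KnRel.h_h (i + 1) (by omega) (by omega)))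

theorem exists_eq_pow_mul_ev (hrel : ∀ t u, KnRel n t u → rel t u) (x : PresentedMonoid rel) :
    ∃ (k : ℕ) (w : List ℕ), (∀ i ∈ w, i < n - 1) ∧
      x = PresentedMonoid.of rel DGen.c ^ k * ev (pdiap rel) w := by
  have H := isDiapsidal_pdiap hrel
  induction x using PresentedMonoid.inductionOn with
  | _ w =>
    induction w using FreeMonoid.inductionOn' with
    | one => exact ⟨0, [], by simp, by simp⟩
    | of_mul g w ih =>
      obtain ⟨k, w', hw', e⟩ := ih
      rw [map_mul, e]
      cases g with
      | c => exact ⟨k + 1, w', hw', by rw [pow_succ', mul_assoc]; rfl⟩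
      | h i hi hi' =>
        obtain ⟨i, rfl⟩ : ∃ j, i = j + 1 := ⟨i - 1, by omega⟩
        refine ⟨k, i :: w', ?_, ?_⟩
        · intro j hj
          rcases List.mem_cons.1 hj with rfl | hj
          · omega
          · exact hw' j hj
        · have hc : Commute (pdiap rel i) (PresentedMonoid.of rel DGen.c ^ k) :=
            Commute.pow_right (H.h_c i (by omega)) k
          rw [ev_cons, ← mul_assoc, ← mul_assoc, ← hc.eq, pdiap_of_lt hi']
          rfl

theorem exists_eq_pow_mul_nf (hrel : ∀ t u, KnRel n t u → rel t u) (x : PresentedMonoid rel) :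
    ∃ (k p : ℕ) (v : List ℕ), NF (n - 1) p v ∧
      x = PresentedMonoid.of rel DGen.c ^ k * ev (pdiap rel) v := by
  obtain ⟨k, w, hw, rfl⟩ := exists_eq_pow_mul_ev hrel x
  obtain ⟨l, p, v, hv, e⟩ := (isDiapsidal_pdiap hrel).exists_nf le_rfl w hw
  exact ⟨k + l, p, v, hv, by rw [e, ← mul_assoc, pow_add]⟩

variable {κ : Kind}

/-- The images of the generators in the monoid of endomorphisms. -/
def endGen (κ : Kind) (n : ℕ) : DGen n → End (⟨n⟩ : FreeCat κ)
  | .h i _ _ => Arr.diapsis κ n (i - 1)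
  | .c => kap κ n

theorem endGen_rel (hκ : κ ≠ Kind.L) {x y : FreeMonoid (DGen n)} (h : KnRel n x y) :
    FreeMonoid.lift (endGen κ n) x = FreeMonoid.lift (endGen κ n) y := by
  cases h with
  | h_comm i j hi hi' hj hj' hij =>
    simp only [map_mul, wh, FreeMonoid.lift_eval_of, endGen]
    exact Arr.diapsis_comm (n := n) (by omega) (by omega)
  | h_braid i j hi hi' hj hj' hij =>
    simp only [map_mul, wh, FreeMonoid.lift_eval_of, endGen]
    rcases hij with rfl | rfl
    · obtain ⟨i, rfl⟩ : ∃ k, i = k + 1 := ⟨i - 1, by omega⟩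
      exact Arr.diapsis_braid_up (n := n) (by omega)
    · obtain ⟨j, rfl⟩ : ∃ k, j = k + 1 := ⟨j - 1, by omega⟩
      exact Arr.diapsis_braid_down (n := n) (by omega)
  | h_c i hi hi' =>
    simp only [map_mul, wh, wc, FreeMonoid.lift_eval_of, endGen]
    exact Arr.comp_circ _
  | h_h i hi hi' =>
    simp only [map_mul, wh, wc, FreeMonoid.lift_eval_of, endGen]
    exact Arr.diapsis_comp_self hκ (n := n) (by omega)

/-- The homomorphism to the monoid of endomorphisms. -/
def endHom (rel : FreeMonoid (DGen n) → FreeMonoid (DGen n) → Prop)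
    (h : ∀ x y, rel x y → FreeMonoid.lift (endGen κ n) x = FreeMonoid.lift (endGen κ n) y) :
    PresentedMonoid rel →* End (⟨n⟩ : FreeCat κ) :=
  PresentedMonoid.lift (endGen κ n) h

variable (h : ∀ x y, rel x y → FreeMonoid.lift (endGen κ n) x = FreeMonoid.lift (endGen κ n) y)

theorem endHom_pdiap {i : ℕ} (hi : i + 1 < n) :
    endHom rel h (pdiap rel i) = Arr.diapsis κ n i := by
  rw [pdiap_of_lt hi]
  exact PresentedMonoid.lift_of _ _

theorem endHom_c : endHom rel h (PresentedMonoid.of rel DGen.c) = kap κ n :=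
  PresentedMonoid.lift_of _ _

theorem any_endHom_h (i : ℕ) (hi : 1 ≤ i) (hi' : i < n) :
    Any.mk (H := Arr κ) (dom := n) (cod := n)
      (endHom rel h (PresentedMonoid.of rel (DGen.h i hi hi'))) = diapArr κ n i := by
  obtain ⟨i, rfl⟩ : ∃ k, i = k + 1 := ⟨i - 1, by omega⟩
  exact Arr.mk_diapsis (by omega)

/-- An endomorphism is in the submonoid generated by the diapsides and the circle. -/
theorem exists_ev_of_diap (hκ : κ ≠ Kind.L) {n : ℕ} {f : Arr κ n n} (hf : Arr.Diap κ n f) :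
    ∃ (k : ℕ) (w : List ℕ), (∀ i ∈ w, i + 1 < n) ∧
      f = (kap κ n ^ k * ev (M := End (⟨n⟩ : FreeCat κ)) (Arr.diapsis κ n) w : End _) := by
  induction hf with
  | one n => exact ⟨0, [], by simp, by rw [pow_zero, ev_nil, mul_one]; rfl⟩
  | circ n => exact ⟨1, [], by simp, by rw [pow_one, ev_nil, mul_one]; rfl⟩
  | turn n =>
    refine ⟨0, [n], by simp, ?_⟩
    rw [pow_zero, ev_singleton, one_mul, Arr.diapsis_self]
  | @F n f _ ih =>
    obtain ⟨k, w, hw, e⟩ := ih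
    refine ⟨k, w, fun i hi => (hw i hi).trans (Nat.lt_succ_self n), ?_⟩
    have h₁ : ∀ k : ℕ, Arr.F (kap κ n ^ k : End (⟨n⟩ : FreeCat κ)) =
        (kap κ (n + 1) ^ k : End (⟨n + 1⟩ : FreeCat κ)) := by
      intro k
      induction k with
      | zero => exact Arr.F_one n
      | succ k ih =>
        rw [pow_succ, pow_succ, ← ih]
        refine (Arr.F_comp _ _).trans ?_
        exact congrArg _ (Arr.F_circ hκ n)
    have h₂ : ∀ w : List ℕ, (∀ i ∈ w, i + 1 < n) →
        Arr.F (ev (M := End (⟨n⟩ : FreeCat κ)) (Arr.diapsis κ n) w) =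
        ev (M := End (⟨n + 1⟩ : FreeCat κ)) (Arr.diapsis κ (n + 1)) w := by
      intro w hw
      induction w with
      | nil => exact Arr.F_one n
      | cons i w ih =>
        rw [ev_cons, ev_cons, ← ih fun j hj => hw j (by simp [hj]),
          Arr.diapsis_succ (Nat.succ_le_of_lt (hw i (by simp)))]
        exact Arr.F_comp _ _
    rw [← h₁, ← h₂ w hw, e]
    exact Arr.F_comp _ _
  | @comp n g f _ _ ihg ihf =>
    obtain ⟨k, w, hw, e⟩ := ihg
    obtain ⟨l, w', hw', e'⟩ := ihf
    refine ⟨k + l, w ++ w', ?_, ?_⟩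
    · intro i hi
      rcases List.mem_append.1 hi with hi | hi
      · exact hw i hi
      · exact hw' i hi
    · have hc : ∀ x : End (⟨n⟩ : FreeCat κ), Commute x (kap κ n ^ l) := fun x =>
        have hx : Commute x (kap κ n) := Arr.comp_circ (κ := κ) (m := n) x
        hx.pow_right l
      rw [pow_add, ev_append, mul_assoc, ← mul_assoc (kap κ n ^ l), ← (hc _).eq,
        mul_assoc _ (kap κ n ^ l), ← mul_assoc, e, e']
      rfl

theorem endHom_surjective (hκ : κ ≠ Kind.L) : Function.Surjective (endHom rel h) := by
  intro f
  obtain ⟨k, w, hw, e⟩ := exists_ev_of_diap hκ (Arr.diap hκ f)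
  refine ⟨PresentedMonoid.of rel DGen.c ^ k * ev (pdiap rel) w, ?_⟩
  rw [map_mul, map_pow, endHom_c, show f = _ from e]
  congr 1
  clear e
  induction w with
  | nil => exact map_one _
  | cons i w ih =>
    rw [ev_cons, ev_cons, map_mul, ih fun j hj => hw j (by simp [hj]),
      endHom_pdiap h (hw i (by simp))]

variable {A : Type} [AddCommMonoid A] (hA : κ = Kind.J → ∀ a : A, a + a = a)

/-! ### Injectivity through the model -/

theorem arrInterp_comp {m n k : ℕ} (g : Arr κ n k) (f : Arr κ m n) :
    Iter.arrInterp A hA (g.comp f) = (Iter.arrInterp A hA g).comp (Iter.arrInterp A hA f) := by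
  induction f using Quotient.inductionOn with
  | _ f =>
    induction g using Quotient.inductionOn with
    | _ g => rfl

theorem arrInterp_F {m n : ℕ} (f : Arr κ m n) :
    Iter.arrInterp A hA f.F = Iter.F (Iter.arrInterp A hA f) := by
  induction f using Quotient.inductionOn with
  | _ f => rfl

theorem arrInterp_kap_pow {n : ℕ} (k : ℕ) (x : Iter A n) :
    Iter.arrInterp A hA (kap κ n ^ k : End (⟨n⟩ : FreeCat κ)) x = 2 ^ k • x := by
  induction k with
  | zero => exact (one_nsmul x).symm
  | succ k ih =>
    rw [pow_succ', pow_succ, mul_nsmul, ← ih, two_nsmul]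
    exact DFunLike.congr_fun (arrInterp_comp hA (kap κ n) _) x

theorem arrInterp_diapsis : (n i : ℕ) →
    Iter.arrInterp A hA (Arr.diapsis κ n i) = Iter.diap n i
  | 0, _ => rfl
  | 1, _ => rfl
  | n + 2, i => by
    rw [Arr.diapsis, Iter.diap]
    split
    · rfl
    · rw [arrInterp_F, arrInterp_diapsis]

theorem arrInterp_endHom {k : ℕ} {v : List ℕ} (hv : ∀ i ∈ v, i < n - 1) (x : Iter A n) :
    Iter.arrInterp A hA (endHom rel h (PresentedMonoid.of rel DGen.c ^ k * ev (pdiap rel) v)) x =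
      2 ^ k • Iter.word A n v x := by
  rw [map_mul, map_pow, endHom_c]
  have key : Iter.arrInterp A hA (endHom rel h (ev (pdiap rel) v)) = Iter.word A n v := by
    induction v with
    | nil => rw [ev_nil, map_one]; rfl
    | cons i v ih =>
      rw [ev_cons, map_mul, Iter.word_cons, ← ih fun j hj => hv j (by simp [hj]),
        ← arrInterp_diapsis hA, ← endHom_pdiap h (Nat.add_lt_of_lt_sub (hv i (by simp)))]
      exact arrInterp_comp hA _ _
  rw [← key, ← arrInterp_kap_pow hA]
  exact DFunLike.congr_fun (arrInterp_comp hA _ _) x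

theorem nf_eq_of_support {e : A} (he : e ≠ 0) {p p' : ℕ} {v v' : List ℕ} (hv : NF (n - 1) p v)
    (hv' : NF (n - 1) p' v') (hR : ∀ x y, Iter.Rel e n v x y ↔ Iter.Rel e n v' x y) : v = v' := by
  cases n with
  | zero => cases hv; cases hv'; rfl
  | succ n => exact Iter.nf_eq_of_rel he hv hv' fun x y _ _ => hR x y

theorem exists_rel {e : A} (he : e ≠ 0) {p : ℕ} {v : List ℕ} (hv : NF (n - 1) p v) :
    ∃ x y, Iter.Rel e n v x y := by
  cases n with
  | zero => cases hv; exact ⟨[], [], Iter.rel_nil he rfl⟩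
  | succ n => exact ⟨_, _, Iter.rel_false he hv⟩

/-- Over `ℕ` the circles multiply each coefficient by `2 ^ k`, which is nonzero, so the support
gives `v = v'`. One nonzero coefficient then gives `k = l`. -/
theorem endHom_injective_K
    (h : ∀ x y, KnRel n x y →
      FreeMonoid.lift (endGen Kind.K n) x = FreeMonoid.lift (endGen Kind.K n) y) :
    Function.Injective (endHom (KnRel n) h) := by
  intro a b hab
  obtain ⟨k, p, v, hv, rfl⟩ := exists_eq_pow_mul_nf (fun _ _ hr => hr) a
  obtain ⟨l, q, v', hv', rfl⟩ := exists_eq_pow_mul_nf (fun _ _ hr => hr) b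
  have hA : Kind.K = Kind.J → ∀ a : ℕ, a + a = a := fun hJ => by cases hJ
  have hc : ∀ x y, 2 ^ k * Iter.coord n (Iter.word ℕ n v (Iter.basis 1 n x)) y =
      2 ^ l * Iter.coord n (Iter.word ℕ n v' (Iter.basis 1 n x)) y := by
    intro x y
    have := congrArg (fun f => Iter.coord n (Iter.arrInterp ℕ hA f (Iter.basis 1 n x)) y) hab
    simpa only [arrInterp_endHom h hA hv.lt_of_mem, arrInterp_endHom h hA hv'.lt_of_mem,
      Iter.coord_nsmul, smul_eq_mul] using this
  have hk : (2 : ℕ) ^ k ≠ 0 := pow_ne_zero k two_ne_zero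
  have hl : (2 : ℕ) ^ l ≠ 0 := pow_ne_zero l two_ne_zero
  obtain rfl : v = v' := by
    refine nf_eq_of_support (A := ℕ) one_ne_zero hv hv' fun x y => not_congr ?_
    rw [← mul_eq_zero_iff_left hk, hc, mul_eq_zero_iff_left hl]
  obtain ⟨x, y, hxy⟩ := exists_rel (A := ℕ) one_ne_zero hv
  have := Nat.eq_of_mul_eq_mul_right (Nat.pos_of_ne_zero hxy) (hc x y)
  rw [Nat.pow_right_injective le_rfl this]

theorem endHom_injective_J
    (h : ∀ x y, JnRel n x y →
      FreeMonoid.lift (endGen Kind.J n) x = FreeMonoid.lift (endGen Kind.J n) y) :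
    Function.Injective (endHom (JnRel n) h) := by
  intro a b hab
  have hone : PresentedMonoid.of (JnRel n) DGen.c = 1 :=
    PresentedMonoid.mk_eq_mk_of_rel JnRel.c_eq_one
  have hpow : ∀ (k : ℕ) (w : List ℕ), PresentedMonoid.of (JnRel n) DGen.c ^ k *
      ev (pdiap (JnRel n)) w = PresentedMonoid.of (JnRel n) DGen.c ^ 0 *
      ev (pdiap (JnRel n)) w := fun k w => by rw [hone, one_pow, one_pow]
  obtain ⟨k, p, v, hv, rfl⟩ := exists_eq_pow_mul_nf (fun _ _ hr => JnRel.of_K hr) a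
  obtain ⟨l, q, v', hv', rfl⟩ := exists_eq_pow_mul_nf (fun _ _ hr => JnRel.of_K hr) b
  rw [hpow k, hpow l] at hab ⊢
  -- Addition in `Tropical Bool` is the minimum, hence idempotent as `𝓙` requires, with `trop false`
  -- as its nonzero element.
  have hA : Kind.J = Kind.J → ∀ a : Tropical Bool, a + a = a := fun _ => Tropical.add_self
  have he : (Tropical.trop false : Tropical Bool) ≠ 0 := by decide
  obtain rfl : v = v' := by
    refine nf_eq_of_support he hv hv' fun x y => not_congr ?_
    have := congrArg (fun f => Iter.coord n
      (Iter.arrInterp (Tropical Bool) hA f (Iter.basis (Tropical.trop false) n x)) y) hab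
    simp only [arrInterp_endHom h hA hv.lt_of_mem, arrInterp_endHom h hA hv'.lt_of_mem] at this
    rw [pow_zero, one_nsmul, one_nsmul] at this
    rw [this]
  rfl

end Presented

/-- The triangles settle every type except `0 → 0`, where an arrow is a power of the circle and its
exponent is read off from the factor `2 ^ k` over `ℕ`. -/
theorem Arr.F_injective_K {m n : ℕ} {f g : Arr Kind.K m n} (h : Arr.F f = Arr.F g) : f = g := by
  rcases Nat.eq_zero_or_pos (m + n) with h₀ | h₀
  · obtain ⟨rfl, rfl⟩ : m = 0 ∧ n = 0 := by omega
    have hA : Kind.K = Kind.J → ∀ a : ℕ, a + a = a := fun hJ => by cases hJ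
    have hκ : Kind.K ≠ Kind.L := fun hK => by cases hK
    have key : ∀ f : Arr Kind.K 0 0, ∃ k : ℕ, f = (kap Kind.K 0 ^ k : End _) := by
      intro f
      obtain ⟨k, w, hw, e⟩ := exists_ev_of_diap hκ (Arr.diap hκ f)
      obtain rfl : w = [] := List.eq_nil_iff_forall_not_mem.2 fun i hi => absurd (hw i hi) (by simp)
      exact ⟨k, by rwa [ev_nil, mul_one] at e⟩
    have hfg := congrArg
      (fun x : Arr Kind.K 1 1 => (Iter.arrInterp ℕ hA x (Iter.basis (1 : ℕ) 1 [false])).1) h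
    simp only [arrInterp_F] at hfg
    obtain ⟨k, rfl⟩ := key f
    obtain ⟨l, rfl⟩ := key g
    have hkl : (2 : ℕ) ^ k • (1 : ℕ) = 2 ^ l • (1 : ℕ) :=
      (arrInterp_kap_pow (n := 0) hA k (1 : ℕ)).symm.trans
        (Eq.trans hfg (arrInterp_kap_pow (n := 0) hA l (1 : ℕ)))
    rw [smul_eq_mul, smul_eq_mul, mul_one, mul_one] at hkl
    rw [Nat.pow_right_injective le_rfl hkl]
  · exact Arr.F_injective_of_pos h₀ h

end SelfAdj

/-! ### The theorem -/

theorem mainTheorem2 :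
    -- the lemmata and the isomorphism, for each of the kinds `𝓛`, `𝓚` and `𝓙`
    (∀ κ : Kind,
      (∀ (m n : ℕ) (f g : ArrowTerm m n), f.toArr κ = g.toArr κ →
        (psi f).eval κ = (psi g).eval κ) ∧
      (∀ t u : Term, t.eval κ = u.eval κ →
        StarEq (κ := κ) ⟨(chi t).arr.toArr κ⟩ ⟨(chi u).arr.toArr κ⟩) ∧
      (∀ (m n : ℕ) (f : ArrowTerm m n),
        StarEq (κ := κ) ⟨(chi (psi f)).arr.toArr κ⟩ ⟨f.toArr κ⟩) ∧
      (∃ e : CStar κ ≃* Omega κ,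
        (∀ (m n : ℕ) (f : ArrowTerm m n), e (starClass κ ⟨f⟩) = (psi f).eval κ) ∧
        (∀ t : Term, e.symm (t.eval κ) = starClass κ (chi t)))) ∧
    (∀ t : Term, psi (chi t).arr = t) ∧
    -- cancellation in every `𝓛`-adjunction and in every `𝓙`-adjunction
    (∀ (A : Type u) [Category.{v} A] (F : A ⥤ A) (adj : F ⊣ F),
      (∀ (a b : A) (f g : a ⟶ F.obj b), F.map f = F.map g → f = g) ∧
      (∀ (a b : A) (f g : F.obj a ⟶ b), F.map f = F.map g → f = g) ∧
      ((∀ a : A, adj.unit.app a ≫ adj.counit.app a = 𝟙 a) →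
        ∀ (a b : A) (f g : a ⟶ b), F.map f = F.map g → f = g)) ∧
    -- cancellation in `𝓚_c`
    (∀ (m n : ℕ) (f g : Arr Kind.K m n), f.F = g.F → f = g) ∧
    -- equality in the free self-adjunctions
    (∀ (κ : Kind) (m n : ℕ) (f g : ArrowTerm m n), (κ = Kind.L → 0 < m + n) →
      (f.toArr κ = g.toArr κ ↔ StarEq (κ := κ) ⟨f.toArr κ⟩ ⟨g.toArr κ⟩) ∧
      (f.toArr κ = g.toArr κ ↔ (psi f).eval κ = (psi g).eval κ)) ∧
    -- the monoids of endomorphisms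
    (∀ n : ℕ, ∃ e : Kn n ≃* End (⟨n⟩ : FreeCat Kind.K),
      (∀ (i : ℕ) (hi : 1 ≤ i) (hi' : i < n),
        Any.mk (H := Arr Kind.K) (dom := n) (cod := n)
          (e (PresentedMonoid.of (KnRel n) (DGen.h i hi hi'))) =
          diapArr Kind.K n i) ∧
      e (PresentedMonoid.of (KnRel n) DGen.c) = kap Kind.K n) ∧
    (∀ n : ℕ, ∃ e : Jn n ≃* End (⟨n⟩ : FreeCat Kind.J),
      (∀ (i : ℕ) (hi : 1 ≤ i) (hi' : i < n),
        Any.mk (H := Arr Kind.J) (dom := n) (cod := n)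
          (e (PresentedMonoid.of (JnRel n) (DGen.h i hi hi'))) =
          diapArr Kind.J n i) ∧
      e (PresentedMonoid.of (JnRel n) DGen.c) = kap Kind.J n) := by
  refine ⟨fun κ => ⟨?_, ?_, ?_, starEquiv κ, ?_, ?_⟩, psi_chi, ?_, ?_, ?_, ?_, ?_⟩
  · intro m n f g h
    exact eval_psi_eq (Quotient.exact h)
  · intro t u h
    rw [starEq_iff, psi_chi, psi_chi, h]
  · intro m n f
    rw [starEq_iff, psi_chi]
  · intro m n f
    exact starEquiv_starClass f
  · exact starEquiv_symm_eval
  · intro A _ F adj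
    exact ⟨fun _ _ _ _ h => map_injective_of_cod adj h,
      fun _ _ _ _ h => map_injective_of_dom adj h,
      fun hc _ _ _ _ h => map_injective_of_circle adj hc h⟩
  · intro m n f g h
    exact Arr.F_injective_K h
  · intro κ m n f g hκ
    have h : f.toArr κ = g.toArr κ ↔ StarEq (κ := κ) ⟨f.toArr κ⟩ ⟨g.toArr κ⟩ := by
      constructor
      · intro h
        rw [h]
        exact (StarEq.equivalence κ).refl _
      · refine eq_of_starEq fun j f g h => ?_
        match κ, hκ, f, g, h with
        | .L, hκ, f, g, h =>
          have := hκ rfl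
          exact Arr.F_injective_of_pos (by omega) h
        | .K, _, f, g, h => exact Arr.F_injective_K h
        | .J, _, f, g, h => exact Arr.F_injective_J h
    exact ⟨h, h.trans (starEq_iff f g)⟩
  · intro n
    have hκ : Kind.K ≠ Kind.L := fun hK => by cases hK
    have hrel : ∀ x y, KnRel n x y →
        FreeMonoid.lift (endGen Kind.K n) x = FreeMonoid.lift (endGen Kind.K n) y :=
      fun _ _ h => endGen_rel hκ h
    refine ⟨MulEquiv.ofBijective (endHom (KnRel n) hrel)
      ⟨endHom_injective_K hrel, endHom_surjective hrel hκ⟩, ?_, endHom_c hrel⟩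
    intro i hi hi'
    exact any_endHom_h hrel i hi hi'
  · intro n
    have hκ : Kind.J ≠ Kind.L := fun hJ => by cases hJ
    have hrel : ∀ x y, JnRel n x y →
        FreeMonoid.lift (endGen Kind.J n) x = FreeMonoid.lift (endGen Kind.J n) y := by
      intro x y h
      cases h with
      | of_K h => exact endGen_rel hκ h
      | c_eq_one => exact Quotient.sound (TermEq.phi_gam_J rfl n)
    refine ⟨MulEquiv.ofBijective (endHom (JnRel n) hrel)
      ⟨endHom_injective_J hrel, endHom_surjective hrel hκ⟩, ?_, endHom_c hrel⟩
    intro i hi hi'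
    exact any_endHom_h hrel i hi hi'
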